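/- Let $\Omega\subset\mathbb R^d$ be a bounded open polytope, equal to the interior of its closure, let $T$ be a conforming triangulation of $\overline\Omega$ into finitely many $d$-simplices, and let $\Gamma\subseteq\partial\Omega$ be measurable (the Neumann part; $\partial\Omega\setminus\Gamma$ is the Dirichlet part). Let $2\le p<\infty$ and $\frac1p+\frac1q=1$. Let $V_h$ be the space of continuous functions on $\overline\Omega$ that are affine on every simplex of $T$ and vanish on $\partial\Omega\setminus\Gamma$. Let $f\in L^q(\Omega)$, let $h\in L^q(\Gamma)$ (surface measure), and let $g$ be continuous and affine on every simplex of $T$. Write $\|v\|_{X^p}^p=\int_\Omega\|\nabla v\|_2^p\,dx$ and $$J_p(u)=\tfrac1p\|u+g\|_{X^p}^p-\int_\Gamma hu\,d\Gamma-\int_\Omega fu\,dx .$$ Let $C_T\in[0,\infty]$ be the Sobolev trace constant, i.e. the smallest constant such that $\|v\|_{L^p(\partial\Omega)}\le C_T\,(\|v\|_{L^p(\Omega)}+\|\nabla v\|_{L^p(\Omega)})$ for all $v\in W^{1,p}(\Omega)\cap C(\overline\Omega)$. Call $L\in[0,\infty]$ admissible if $L\ge L_*$, where $L_*$ is the smallest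 number such that the Friedrichs inequality $\|v\|_{L^p(\Omega)}\le L_*\,p^{-1/p}\|\nabla v\|_{L^p(\Omega)}$ holds for all $v\in V_h$ ($L_*=\infty$ if there is none). Put $$R_0=2+4\|g\|_{X^p}^p+8(p-1)\Big[L^q\|f\|_{L^q(\Omega)}^q+C_T^q\,(L^q+1)\,\|h\|_{L^q(\Gamma)}^q\Big]\qquad(\infty\cdot0=0).$$ (1) Suppose that $\Omega$ lies between two parallel hyperplanes at distance $w$ with unit normal $e$, and that from almost every point of $\Omega$ at least one of the two rays in the directions $\pm e$ first leaves $\Omega$ through a point of $\partial\Omega\setminus\Gamma$ (this is automatic if $\Gamma=\emptyset$). Then the width $L=w$ is admissible. (2) Let $L$ be admissible and let $u\in V_h$ be any minimizer of $J_p$ over $V_h$. Then for every real $R\ge R_0$ (in particular for $R=R_0$ when $R_0<\infty$) we have $\|u+g\|_{X^p}^p\le R$, and $u$, together with $s_i=\|\nabla(u+g)|_{K_i}\|_2^p$, lies in the search set $$\mathcal Q=\Big\{(u,s): u\in V_h,\ s_i\ge\|\nabla(u+g)|_{K_i}\|_2^p\ \text{ and }\ |K_i|\,s_i\le R\ \text{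 for every simplex }K_i\text{ of }T\Big\}.$$ -/

import Mathlib

open MeasureTheory
open scoped ENNReal ContDiff

noncomputable section

namespace PLaplace

/-- Euclidean space `ℝᵈ`. -/
abbrev E (d : ℕ) : Type := EuclideanSpace ℝ (Fin d)

/-- The `(d-1)`-dimensional surface measure on `ℝᵈ` (the Hausdorff measure, normalized so that it
agrees with Lebesgue measure on hyperplanes). -/
def surf (d : ℕ) : Measure (E d) := Measure.euclideanHausdorffMeasure (d - 1)

/-! ### Triangulations and piecewise linear finite elements -/

/-- `K` is a (conforming) triangulation of the open polytope `Ω`: finitely many simplices, all of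
them faces of `d`-simplices, whose union is the closure of `Ω`; and `Ω` is the interior of its
closure (in particular `Ω` is open and, `K` being finite, bounded). -/
structure IsTriangulation {d : ℕ} (K : Geometry.SimplicialComplex ℝ (E d)) (Ω : Set (E d)) :
    Prop where
  finite : K.faces.Finite
  pure : ∀ s ∈ K.faces, ∃ t ∈ K.faces, s ⊆ t ∧ t.card = d + 1
  space_eq : K.space = closure Ω
  interior_eq : interior (closure Ω) = Ω

/-- The elements of a triangulation: its `d`-dimensional simplices (given by their vertices). -/
def elements {d : ℕ} (K : Geometry.SimplicialComplex ℝ (E d)) : Set (Finset (E d)) :=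
  {t | t ∈ K.faces ∧ t.card = d + 1}

/-- The volume `ω_t` of the element `t`. -/
def weight {d : ℕ} (t : Finset (E d)) : ℝ :=
  volume.real (convexHull ℝ (t : Set (E d)))

/-- The midpoint (barycenter) of the element `t`. -/
def midpt {d : ℕ} (t : Finset (E d)) : E d := t.centroid ℝ id

/-- `v` is continuous and piecewise linear on the triangulation `K`. Only the values of `v` on
`K.space` matter. -/
def IsPiecewiseLinear {d : ℕ} (K : Geometry.SimplicialComplex ℝ (E d)) (v : E d → ℝ) : Prop :=
  ContinuousOn v K.space ∧
    ∀ t ∈ elements K, ∃ A : E d →ᵃ[ℝ] ℝ, Set.EqOn v A (convexHull ℝ (t : Set (E d)))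

/-- The finite element space `V_h`: continuous piecewise linear functions on `K` whose boundary
values vanish on the Dirichlet part `∂Ω \ Γ`. -/
def feSpace {d : ℕ} (K : Geometry.SimplicialComplex ℝ (E d)) (Ω Γ : Set (E d)) :
    Set (E d → ℝ) :=
  {u | IsPiecewiseLinear K u ∧ ∀ x ∈ frontier Ω \ Γ, u x = 0}

/-! ### The functional and the search set -/

/-- `‖v‖_{X^p(Ω)}^p = ∫_Ω ‖∇v‖₂^p`. -/
def xNormPow {d : ℕ} (Ω : Set (E d)) (p : ℝ) (v : E d → ℝ) : ℝ :=
  ∫ x in Ω, ‖gradient v x‖ ^ p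

/-- `J_p(u) = (1/p) ‖u + g‖_{X^p(Ω)}^p - ∫_Γ h u dΓ - ∫_Ω f u dx`. -/
def J {d : ℕ} (Ω Γ : Set (E d)) (p : ℝ) (f g h u : E d → ℝ) : ℝ :=
  1 / p * xNormPow Ω p (u + g) - ∫ x in Γ, h x * u x ∂(surf d) - ∫ x in Ω, f x * u x

/-- The search set
`{(u, s) : s_t ≥ ‖∇(u + g)|_t‖₂^p and ω_t s_t ≤ R for every element t}`,
with `u` in the finite element space and one number `s_t` for each element. -/
def searchSet {d : ℕ} (K : Geometry.SimplicialComplex ℝ (E d)) (Ω Γ : Set (E d)) (p : ℝ)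
    (g : E d → ℝ) (R : ℝ) : Set ((E d → ℝ) × (elements K → ℝ)) :=
  {z | z.1 ∈ feSpace K Ω Γ ∧ ∀ t : elements K,
    ‖gradient (z.1 + g) (midpt (t : Finset (E d)))‖ ^ p ≤ z.2 t ∧
      weight (t : Finset (E d)) * z.2 t ≤ R}

/-! ### The Sobolev trace constant -/

/-- `G` is the weak gradient of `v` on the open set `Ω`. -/
def HasWeakGradient {d : ℕ} (Ω : Set (E d)) (v : E d → ℝ) (G : E d → E d) : Prop :=
  LocallyIntegrableOn v Ω ∧ LocallyIntegrableOn G Ω ∧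
    ∀ φ : E d → ℝ, ContDiff ℝ ∞ φ → HasCompactSupport φ → tsupport φ ⊆ Ω →
      ∫ x in Ω, v x • gradient φ x = - ∫ x in Ω, φ x • G x

/-- The Sobolev trace constant `C_T` of `Ω`: the best constant in
`‖v‖_{L^p(∂Ω)} ≤ C (‖v‖_{L^p(Ω)} + ‖∇v‖_{L^p(Ω)})` for `v ∈ W^{1,p}(Ω)`. The infimum is taken over
the functions of `W^{1,p}(Ω)` that are continuous up to the boundary; these are dense in
`W^{1,p}(Ω)` for a Lipschitz domain, and their trace is their restriction to `∂Ω`. -/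
def traceConst {d : ℕ} (Ω : Set (E d)) (p : ℝ) : ℝ≥0∞ :=
  sInf {C | ∀ (v : E d → ℝ) (G : E d → E d), ContinuousOn v (closure Ω) →
    MemLp v (ENNReal.ofReal p) (volume.restrict Ω) →
    MemLp G (ENNReal.ofReal p) (volume.restrict Ω) → HasWeakGradient Ω v G →
    eLpNorm v (ENNReal.ofReal p) ((surf d).restrict (frontier Ω)) ≤
      C * (eLpNorm v (ENNReal.ofReal p) (volume.restrict Ω) +
        eLpNorm G (ENNReal.ofReal p) (volume.restrict Ω))}

/-! ### The length `L` -/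

/-- The Friedrichs length: the smallest `L` such that the Friedrichs inequality
`‖v‖_{L^p(Ω)} ≤ L p^{-1/p} ‖∇v‖_{L^p(Ω)}` holds for all `v` in the finite element space
(`⊤` if there is none). -/
def friedrichsLength {d : ℕ} (K : Geometry.SimplicialComplex ℝ (E d)) (Ω Γ : Set (E d)) (p : ℝ) :
    ℝ≥0∞ :=
  sInf {L | ∀ v ∈ feSpace K Ω Γ,
    eLpNorm v (ENNReal.ofReal p) (volume.restrict Ω) ≤
      L * ENNReal.ofReal (p ^ (-(1 / p))) *
        eLpNorm (gradient v) (ENNReal.ofReal p) (volume.restrict Ω)}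

/-- `Ω` has width (at most) `w` in a direction in which the Dirichlet part of the boundary is seen:
for some unit vector `e`, `Ω` lies between two hyperplanes orthogonal to `e` at distance `w`, and
from almost every point of `Ω` one of the two rays in the directions `e` and `-e` leaves `Ω`
through `∂Ω \ Γ`. For `Γ = ∅` the last condition always holds, so that this is the usual
width. -/
def HasDirichletWidth {d : ℕ} (Ω Γ : Set (E d)) (w : ℝ) : Prop :=
  ∃ e : E d, ‖e‖ = 1 ∧ (∃ a : ℝ, ∀ x ∈ Ω, a ≤ inner ℝ e x ∧ inner ℝ e x ≤ a + w) ∧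
    ∀ᵐ x ∂(volume.restrict Ω), ∃ t : ℝ,
      x + t • e ∈ frontier Ω \ Γ ∧ openSegment ℝ x (x + t • e) ⊆ Ω

/-- The number
`2 + 4 ‖g‖_{X^p}^p + 8 (p-1) [L^q ‖f‖_{L^q(Ω)}^q + C_T^q (L^q + 1) ‖h‖_{L^q(Γ)}^q]`
(in `[0, ∞]`, where `∞ · 0 = 0`). -/
def searchBound {d : ℕ} (Ω Γ : Set (E d)) (p q : ℝ) (L : ℝ≥0∞) (f g h : E d → ℝ) : ℝ≥0∞ :=
  2 + 4 * ENNReal.ofReal (xNormPow Ω p g) +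
    8 * ENNReal.ofReal (p - 1) *
      (L ^ q * eLpNorm f (ENNReal.ofReal q) (volume.restrict Ω) ^ q +
        traceConst Ω p ^ q * (L ^ q + 1) *
          eLpNorm h (ENNReal.ofReal q) ((surf d).restrict Γ) ^ q)

end PLaplace

end

/-! Admissibility of the width is a Friedrichs inequality proved line by line. On an interval, a
Lipschitz function vanishing at one end satisfies, by the fundamental theorem of calculus and
Hölder, a pointwise bound whose integral gives the factor `w ^ p / p`; hence the normalization `p ^
(-(1 / p))` in `friedrichsLength`. A line in direction `e` meets `Ω` in an open set, and almost
every line has an endpoint on the Dirichlet part for each component (`lintegral_rpow_le_of_isOpen`).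
Averaging over lines (`lintegral_eq_lintegral_lines`) gives the inequality on `Ω`.

For the bound, write `X` and `G` for the `L^p` norms of the gradients of `u + g` and `g`. The
competitor `(1 - t) • u` satisfies `(1 - t) • u + g = (1 - t) • (u + g) + t • g`, so Minkowski's
inequality and the right derivative at `t = 0` give `X ^ p ≤ X ^ (p - 1) * G + l`, where `l` is the
load at `u` (`rpow_le_of_minimizer`). Hölder, the Friedrichs inequality and the trace inequality
bound `l` by `S * (X + G)` (`enorm_load_le`, `gradNorm_le_add`). The trace inequality applies
because the classical gradient of a finite element function is its weak gradient
(`IsPiecewiseLinear.hasWeakGradient`). Young's inequality then absorbs all powers of `X`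
(`rpow_le_of_variational`). Membership in the search set follows because one element contributes at
most the whole integral (`weight_mul_le_xNormPow`). -/

namespace PLaplace

/-! ### One-dimensional Friedrichs inequalities -/

/-- A function that is `C`-Lipschitz on each of finitely many closed sets covering an interval is
`C`-Lipschitz on that interval. -/
theorem abs_sub_le_of_finite_closed_cover {ι : Type*} {F : ι → Set ℝ} (hF : ∀ i, IsClosed (F i))
    {f : ℝ → ℝ} {C : ℝ} (s : Finset ι)
    (hC : ∀ i ∈ s, ∀ a ∈ F i, ∀ b ∈ F i, |f a - f b| ≤ C * |a - b|) {x y : ℝ} (hxy : x ≤ y)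
    (hs : Set.Icc x y ⊆ ⋃ i ∈ s, F i) : |f y - f x| ≤ C * (y - x) := by
  classical
  induction s using Finset.strongInduction generalizing x with
  | H s ih =>
    obtain ⟨i, hi, hxi⟩ : ∃ i ∈ s, x ∈ F i := by
      simpa using hs (Set.left_mem_Icc.2 hxy)
    have hcpt : IsCompact (Set.Icc x y ∩ F i) := isCompact_Icc.inter_right (hF i)
    -- `z` is the last point of `F i` in the interval. Beyond it the other sets suffice as a cover,
    -- and since their union is closed it also contains `z` when `z < y`.
    obtain ⟨z, ⟨⟨hxz, hzy⟩, hzi⟩, hmax⟩ :=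
      hcpt.exists_isGreatest ⟨x, Set.left_mem_Icc.2 hxy, hxi⟩
    have h1 : |f z - f x| ≤ C * (z - x) := by
      simpa [abs_of_nonneg (sub_nonneg.2 hxz)] using hC i hi z hzi x hxi
    rcases hzy.eq_or_lt with rfl | hlt
    · exact h1
    have hcl : IsClosed (⋃ j ∈ s.erase i, F j) :=
      (s.erase i).finite_toSet.isClosed_biUnion fun j _ => hF j
    have hsub : Set.Ioc z y ⊆ ⋃ j ∈ s.erase i, F j := by
      intro r hr
      obtain ⟨j, hj, hrj⟩ : ∃ j ∈ s, r ∈ F j := by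
        simpa using hs (⟨hxz.trans hr.1.le, hr.2⟩ : r ∈ Set.Icc x y)
      have hji : j ≠ i := by
        rintro rfl
        exact absurd (hmax ⟨⟨hxz.trans hr.1.le, hr.2⟩, hrj⟩) (not_le.2 hr.1)
      simp only [Set.mem_iUnion]
      exact ⟨j, Finset.mem_erase.2 ⟨hji, hj⟩, hrj⟩
    have hIcc : Set.Icc z y ⊆ ⋃ j ∈ s.erase i, F j := by
      rw [← closure_Ioc hlt.ne]
      exact closure_minimal hsub hcl
    have h2 := ih (s.erase i) (Finset.erase_ssubset hi)
      (fun j hj => hC j (Finset.mem_of_mem_erase hj)) hlt.le hIcc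
    calc |f y - f x| ≤ |f y - f z| + |f z - f x| := abs_sub_le _ _ _
      _ ≤ C * (y - z) + C * (z - x) := add_le_add h2 h1
      _ = C * (y - x) := by ring

/-- The Friedrichs inequality on an interval for a function vanishing at the left endpoint. -/
theorem lintegral_Ioo_rpow_le_of_left {F : ℝ → ℝ} {α β p : ℝ} {C : NNReal} (hp : 1 < p)
    (hαβ : α < β) (hF : LipschitzOnWith C F (Set.Icc α β)) (hα : F α = 0) :
    ∫⁻ s in Set.Ioo α β, ‖F s‖ₑ ^ p ≤
      ENNReal.ofReal ((β - α) ^ p / p) * ∫⁻ s in Set.Ioo α β, ‖deriv F s‖ₑ ^ p := by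
  have hpq := Real.HolderConjugate.conjExponent hp
  set q := p.conjExponent
  set I := ∫⁻ s in Set.Ioo α β, ‖deriv F s‖ₑ ^ p with hI
  have hp0 : 0 < p := by linarith
  -- Hölder on `(α, s]` produces the power `p / q = p - 1` of the length; integrating it over `s`
  -- later yields the gain `1 / p`.
  have key : ∀ s ∈ Set.Ioo α β, ‖F s‖ₑ ^ p ≤ I * ENNReal.ofReal ((s - α) ^ (p - 1)) := by
    intro s hs
    have hac : AbsolutelyContinuousOnInterval F α s := by
      apply LipschitzOnWith.absolutelyContinuousOnInterval (K := C)
      rw [Set.uIcc_of_le hs.1.le]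
      exact hF.mono (Set.Icc_subset_Icc_right hs.2.le)
    have hFs : F s = ∫ r in α..s, deriv F r := by
      rw [hac.integral_deriv_eq_sub, hα, sub_zero]
    have h1 : ‖F s‖ₑ ≤ ∫⁻ r in Set.Ioc α s, ‖deriv F r‖ₑ := by
      rw [hFs, intervalIntegral.integral_of_le hs.1.le]
      exact enorm_integral_le_lintegral_enorm _
    have h2 : ∫⁻ r in Set.Ioc α s, ‖deriv F r‖ₑ ≤
        (∫⁻ r in Set.Ioc α s, ‖deriv F r‖ₑ ^ p) ^ (1 / p) *
          (∫⁻ r in Set.Ioc α s, 1 ^ q) ^ (1 / q) := by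
      have := ENNReal.lintegral_mul_le_Lp_mul_Lq (volume.restrict (Set.Ioc α s)) hpq
        (f := fun r => ‖deriv F r‖ₑ) (g := fun _ => 1)
        (measurable_deriv F).enorm.aemeasurable aemeasurable_const
      simpa using this
    have h3 : ∫⁻ r in Set.Ioc α s, ‖deriv F r‖ₑ ^ p ≤ I :=
      lintegral_mono_set fun r hr => ⟨hr.1, hr.2.trans_lt hs.2⟩
    have h4 : (∫⁻ r in Set.Ioc α s, (1 : ℝ≥0∞) ^ q) = ENNReal.ofReal (s - α) := by simp
    calc ‖F s‖ₑ ^ p ≤ (I ^ (1 / p) * (ENNReal.ofReal (s - α)) ^ (1 / q)) ^ p := by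
          gcongr
          refine h1.trans (h2.trans ?_)
          rw [h4]
          gcongr
      _ = I * ENNReal.ofReal ((s - α) ^ (p - 1)) := by
          rw [ENNReal.mul_rpow_of_nonneg _ _ hp0.le, ← ENNReal.rpow_mul, ← ENNReal.rpow_mul,
            one_div_mul_cancel hp0.ne', ENNReal.rpow_one,
            ENNReal.ofReal_rpow_of_pos (sub_pos.2 hs.1)]
          congr 3
          rw [one_div_mul_eq_div]
          exact hpq.div_conj_eq_sub_one
  calc ∫⁻ s in Set.Ioo α β, ‖F s‖ₑ ^ p
      ≤ ∫⁻ s in Set.Ioo α β, I * ENNReal.ofReal ((s - α) ^ (p - 1)) :=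
        setLIntegral_mono' measurableSet_Ioo key
    _ = I * ∫⁻ s in Set.Ioo α β, ENNReal.ofReal ((s - α) ^ (p - 1)) := by
        rw [lintegral_const_mul]
        fun_prop
    _ = I * ENNReal.ofReal ((β - α) ^ p / p) := by
        congr 1
        have hint : IntervalIntegrable (fun s => (s - α) ^ (p - 1)) volume α β := by
          apply ContinuousOn.intervalIntegrable
          exact (Continuous.rpow_const (by fun_prop) fun _ => Or.inr (by linarith)).continuousOn
        rw [setLIntegral_congr Ioo_ae_eq_Ioc, ← ofReal_integral_eq_lintegral_ofReal
          ((intervalIntegrable_iff_integrableOn_Ioc_of_le hαβ.le).1 hint),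
          ← intervalIntegral.integral_of_le hαβ.le]
        · congr 1
          rw [intervalIntegral.integral_comp_sub_right (fun s => s ^ (p - 1)), sub_self,
            integral_rpow (Or.inl (by linarith))]
          rw [sub_add_cancel, Real.zero_rpow hp0.ne', sub_zero]
        · filter_upwards [self_mem_ae_restrict measurableSet_Ioc] with s hs
          exact Real.rpow_nonneg (sub_nonneg.2 hs.1.le) _
    _ = _ := mul_comm _ _

/-- The Friedrichs inequality on an interval for a function vanishing at the right endpoint. -/
theorem lintegral_Ioo_rpow_le_of_right {F : ℝ → ℝ} {α β p : ℝ} {C : NNReal} (hp : 1 < p)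
    (hαβ : α < β) (hF : LipschitzOnWith C F (Set.Icc α β)) (hβ : F β = 0) :
    ∫⁻ s in Set.Ioo α β, ‖F s‖ₑ ^ p ≤
      ENNReal.ofReal ((β - α) ^ p / p) * ∫⁻ s in Set.Ioo α β, ‖deriv F s‖ₑ ^ p := by
  have hrefl : ∀ ψ : ℝ → ℝ≥0∞, ∫⁻ s in Set.Ioo (-β) (-α), ψ (-s) = ∫⁻ s in Set.Ioo α β, ψ s := by
    intro ψ
    have := (Measure.measurePreserving_neg (volume : Measure ℝ)).setLIntegral_comp_preimage_emb
      (MeasurableEquiv.neg ℝ).measurableEmbedding ψ (Set.Ioo α β)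
    simpa using this
  have hlip : LipschitzOnWith C (fun s => F (-s)) (Set.Icc (-β) (-α)) := by
    intro x hx y hy
    have := hF (x := -x) ⟨by linarith [hx.2], by linarith [hx.1]⟩ (y := -y)
      ⟨by linarith [hy.2], by linarith [hy.1]⟩
    simpa using this
  have := lintegral_Ioo_rpow_le_of_left hp (neg_lt_neg hαβ) hlip (by simpa using hβ)
  rw [hrefl (fun s => ‖F s‖ₑ ^ p)] at this
  refine this.trans_eq ?_
  rw [← hrefl (fun s => ‖deriv F s‖ₑ ^ p)]
  simp [deriv_comp_neg, neg_add_eq_sub]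

/-- The Friedrichs inequality on a bounded open subset of the line, for a function that vanishes
at an endpoint of (almost) every component. -/
theorem lintegral_rpow_le_of_isOpen {F : ℝ → ℝ} {D : Set ℝ} {a w p C : ℝ} (hp : 1 < p)
    (hD : IsOpen D) (hDw : D ⊆ Set.Icc a (a + w))
    (hF : ∀ x y, x ≤ y → Set.Icc x y ⊆ closure D → |F y - F x| ≤ C * (y - x))
    (hend : ∀ᵐ s, s ∈ D → ∃ t, F (s + t) = 0 ∧ s + t ∉ D ∧ openSegment ℝ s (s + t) ⊆ D) :
    ∫⁻ s in D, ‖F s‖ₑ ^ p ≤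
      ENNReal.ofReal (w ^ p / p) * ∫⁻ s in D, ‖deriv F s‖ₑ ^ p := by
  set S : Set (Set ℝ) := connectedComponentIn D '' D
  have hSo : ∀ I ∈ S, IsOpen I := by
    rintro _ ⟨x, _, rfl⟩
    exact hD.connectedComponentIn
  have hSne : ∀ I ∈ S, I.Nonempty := by
    rintro _ ⟨x, hx, rfl⟩
    exact ⟨x, mem_connectedComponentIn hx⟩
  have hSd : S.PairwiseDisjoint id := by
    rintro _ ⟨x, hx, rfl⟩ _ ⟨y, hy, rfl⟩ hne
    refine Set.disjoint_left.2 fun z hzx hzy => hne ?_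
    rw [connectedComponentIn_eq hzx, connectedComponentIn_eq hzy]
  have hSc : S.Countable := hSd.countable_of_isOpen hSo hSne
  have hSU : D = ⋃ I ∈ S, I := by
    ext x
    simp only [Set.mem_iUnion, exists_prop]
    constructor
    · exact fun hx => ⟨_, ⟨x, hx, rfl⟩, mem_connectedComponentIn hx⟩
    · rintro ⟨_, ⟨y, hy, rfl⟩, hx⟩
      exact connectedComponentIn_subset _ _ hx
  have hsum : ∀ ψ : ℝ → ℝ≥0∞, ∫⁻ s in D, ψ s = ∑' I : S, ∫⁻ s in (I : Set ℝ), ψ s := by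
    intro ψ
    conv_lhs => rw [hSU]
    exact lintegral_biUnion hSc (fun I hI => (hSo I hI).measurableSet) hSd ψ
  rw [hsum, hsum, ← ENNReal.tsum_mul_left]
  refine ENNReal.tsum_le_tsum ?_
  rintro ⟨I, hI⟩
  obtain ⟨x, hx, hxI⟩ := hI
  have hIS : I ∈ S := ⟨x, hx, hxI⟩
  have hIc : IsPreconnected I := hxI ▸ isPreconnected_connectedComponentIn
  have hID : I ⊆ D := hxI ▸ connectedComponentIn_subset _ _
  have hbdB : BddBelow I := ⟨a, fun y hy => (hDw (hID hy)).1⟩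
  have hbdA : BddAbove I := ⟨a + w, fun y hy => (hDw (hID hy)).2⟩
  obtain ⟨α, β, rfl⟩ : ∃ α β, I = Set.Ioo α β := by
    refine ⟨sInf I, sSup I, Set.Subset.antisymm ?_ (IsConnected.Ioo_csInf_csSup_subset ⟨hSne I hIS, hIc⟩ hbdB hbdA)⟩
    intro y hy
    have hnhds := (hSo I hIS).mem_nhds hy
    obtain ⟨ε, hε, hball⟩ := Metric.mem_nhds_iff.1 hnhds
    have h1 : y - ε / 2 ∈ I := hball (by simp [abs_of_pos, hε])
    have h2 : y + ε / 2 ∈ I := hball (by simp [abs_of_pos, hε])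
    constructor
    · linarith [csInf_le hbdB h1]
    · linarith [le_csSup hbdA h2]
  have hαβ : α < β := Set.nonempty_Ioo.1 (hSne _ hIS)
  have hmaxl : ∀ J : Set ℝ, IsPreconnected J → J ⊆ D → (J ∩ Set.Ioo α β).Nonempty →
      J ⊆ Set.Ioo α β := by
    rintro J hJ hJD ⟨z, hzJ, hzI⟩
    rw [← hxI] at hzI ⊢
    rw [connectedComponentIn_eq hzI]
    exact hJ.subset_connectedComponentIn hzJ hJD
  have hIcc : Set.Icc α β ⊆ closure D := by
    rw [← closure_Ioo hαβ.ne]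
    exact closure_mono hID
  have hC0 : 0 ≤ C := by
    have := (abs_nonneg _).trans (hF α β hαβ.le hIcc)
    exact nonneg_of_mul_nonneg_left this (sub_pos.2 hαβ)
  have hlip : LipschitzOnWith C.toNNReal F (Set.Icc α β) := by
    apply LipschitzOnWith.of_dist_le_mul
    have haux : ∀ x ∈ Set.Icc α β, ∀ y ∈ Set.Icc α β, x ≤ y → |F x - F y| ≤ C * |x - y| := by
      intro x hx y hy hxy
      rw [abs_sub_comm, abs_sub_comm x, abs_of_nonneg (sub_nonneg.2 hxy)]
      exact hF x y hxy ((Set.Icc_subset_Icc hx.1 hy.2).trans hIcc)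
    intro x hx y hy
    rw [Real.coe_toNNReal _ hC0, Real.dist_eq, Real.dist_eq]
    rcases le_total x y with hxy | hxy
    · exact haux x hx y hy hxy
    · rw [abs_sub_comm, abs_sub_comm x]
      exact haux y hy x hx hxy
  -- The component has positive measure, so it contains a point where the almost-everywhere
  -- hypothesis `hend` applies. The half-open segment from there towards `s + t` is connected and
  -- lies in `D`, hence in the component; as `s + t ∉ D`, it must be an endpoint.
  have hzero : F α = 0 ∨ F β = 0 := by
    obtain ⟨s, hs, t, ht0, htD, hseg⟩ : ∃ s ∈ Set.Ioo α β, ∃ t, F (s + t) = 0 ∧ s + t ∉ D ∧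
        openSegment ℝ s (s + t) ⊆ D := by
      by_contra! hcon
      have hnull : volume (Set.Ioo α β) = 0 := by
        refine measure_mono_null (fun s hs => ?_) (ae_iff.1 hend)
        simp only [Set.mem_ofPred_eq, not_forall]
        refine ⟨hID hs, ?_⟩
        rintro ⟨t, h1, h2, h3⟩
        exact hcon s hs t h1 h2 h3
      simp at hnull
      linarith
    rcases lt_trichotomy t 0 with ht | rfl | ht
    · left
      rw [openSegment_symm, openSegment_eq_Ioo (by linarith)] at hseg
      have hsub := hmaxl (Set.Ioc (s + t) s) isPreconnected_Ioc (by
        intro r hr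
        rcases hr.2.eq_or_lt with rfl | hlt
        · exact hID hs
        · exact hseg ⟨hr.1, hlt⟩) ⟨s, ⟨by linarith, le_rfl⟩, hs⟩
      have h1 : α ≤ s + t := by
        by_contra! hlt
        exact lt_irrefl α (hsub ⟨hlt, hs.1.le⟩).1
      rcases h1.eq_or_lt with h | h
      · rwa [h]
      · exact absurd (hID ⟨h, by linarith [hs.2]⟩) htD
    · exact absurd (hID (by simpa using hs)) htD
    · right
      rw [openSegment_eq_Ioo (by linarith)] at hseg
      have hsub := hmaxl (Set.Ico s (s + t)) isPreconnected_Ico (by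
        intro r hr
        rcases hr.1.eq_or_lt with rfl | hlt
        · exact hID hs
        · exact hseg ⟨hlt, hr.2⟩) ⟨s, ⟨le_rfl, by linarith⟩, hs⟩
      have h1 : s + t ≤ β := by
        by_contra! hlt
        exact lt_irrefl β (hsub ⟨hs.2.le, hlt⟩).2
      rcases h1.eq_or_lt with h | h
      · rwa [← h]
      · exact absurd (hID ⟨by linarith [hs.1], h⟩) htD
  have hlen : β - α ≤ w := by
    have hcl : Set.Icc α β ⊆ Set.Icc a (a + w) := hIcc.trans (closure_minimal hDw isClosed_Icc)
    linarith [(hcl (Set.left_mem_Icc.2 hαβ.le)).1, (hcl (Set.right_mem_Icc.2 hαβ.le)).2]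
  have hfin : ∫⁻ s in Set.Ioo α β, ‖F s‖ₑ ^ p ≤
      ENNReal.ofReal ((β - α) ^ p / p) * ∫⁻ s in Set.Ioo α β, ‖deriv F s‖ₑ ^ p :=
    hzero.elim (lintegral_Ioo_rpow_le_of_left hp hαβ hlip)
      (lintegral_Ioo_rpow_le_of_right hp hαβ hlip)
  refine hfin.trans ?_
  have : 0 ≤ β - α := by linarith
  gcongr

/-! ### Real-variable estimates -/

/-- Young's inequality with a weight. -/
theorem mul_le_weighted_rpow_add {a b η p q : ℝ} (hpq : p.HolderConjugate q) (ha : 0 ≤ a)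
    (hb : 0 ≤ b) (hη : 0 < η) :
    a * b ≤ η * (a ^ p / p) + η ^ (-(q - 1)) * (b ^ q / q) := by
  have hp0 := hpq.pos
  have hq0 := hpq.symm.pos
  have h := Real.young_inequality_of_nonneg (a := η ^ (1 / p) * a) (b := η ^ (-(1 / p)) * b)
    (by positivity) (by positivity) hpq
  have h1 : η ^ (1 / p) * a * (η ^ (-(1 / p)) * b) = a * b := by
    have : η ^ (1 / p) * η ^ (-(1 / p)) = 1 := by
      rw [← Real.rpow_add hη]; simp
    linear_combination a * b * this
  have h2 : (η ^ (1 / p) * a) ^ p = η * a ^ p := by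
    rw [Real.mul_rpow (by positivity) ha, ← Real.rpow_mul hη.le, one_div_mul_cancel hp0.ne',
      Real.rpow_one]
  have h3 : (η ^ (-(1 / p)) * b) ^ q = η ^ (-(q - 1)) * b ^ q := by
    rw [Real.mul_rpow (by positivity) hb, ← Real.rpow_mul hη.le]
    congr 2
    have := hpq.symm.div_conj_eq_sub_one
    rw [← this]; ring
  rw [h1, h2, h3] at h
  calc a * b ≤ _ := h
    _ = _ := by ring

/-- Hölder against the vector `(p ^ (-(1 / p)), p ^ (-(1 / p)), 1)`: its `p`-th powers sum to `2 / p
+ 1`, which is at most `2` because `p ≥ 2`. -/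
theorem sum_rpow_le {a b c p q : ℝ} (hp : 2 ≤ p) (hpq : p.HolderConjugate q) (ha : 0 ≤ a)
    (hb : 0 ≤ b) (hc : 0 ≤ c) :
    (a * p ^ (-(1 / p)) + b * p ^ (-(1 / p)) + c) ^ q ≤ 2 ^ (q - 1) * (a ^ q + b ^ q + c ^ q) := by
  have hp0 : 0 < p := by linarith
  have hq0 := hpq.symm.pos
  have hcp : (p ^ (-(1 / p))) ^ p = 1 / p := by
    rw [← Real.rpow_mul hp0.le, neg_mul, one_div_mul_cancel hp0.ne', Real.rpow_neg_one, one_div]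
  have h := Real.inner_le_Lp_mul_Lq_of_nonneg Finset.univ hpq.symm
    (f := ![a, b, c]) (g := ![p ^ (-(1 / p)), p ^ (-(1 / p)), 1])
    (by intro i _; fin_cases i <;> simpa) (by intro i _; fin_cases i <;> simp; all_goals positivity)
  simp only [Fin.sum_univ_three, Matrix.cons_val_zero, Matrix.cons_val_one, Matrix.cons_val, hcp,
    Real.one_rpow, mul_one] at h
  have hs : 0 ≤ a ^ q + b ^ q + c ^ q := by positivity
  calc (a * p ^ (-(1 / p)) + b * p ^ (-(1 / p)) + c) ^ q
      ≤ ((a ^ q + b ^ q + c ^ q) ^ (1 / q) * (1 / p + 1 / p + 1) ^ (1 / p)) ^ q := by gcongr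
    _ = (a ^ q + b ^ q + c ^ q) * (1 / p + 1 / p + 1) ^ (q - 1) := by
        rw [Real.mul_rpow (by positivity) (by positivity), ← Real.rpow_mul hs,
          one_div_mul_cancel hq0.ne', Real.rpow_one, ← Real.rpow_mul (by positivity),
          ← hpq.symm.div_conj_eq_sub_one]
        congr 2
        ring
    _ ≤ (a ^ q + b ^ q + c ^ q) * 2 ^ (q - 1) := by
        have hq1 : 0 ≤ q - 1 := by linarith [hpq.symm.lt]
        gcongr
        have : 1 / p ≤ 1 / 2 := one_div_le_one_div_of_le (by norm_num) hp
        linarith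
    _ = _ := mul_comm _ _

/-- The inequality behind the search bound: it turns the variational inequality into an explicit
bound. -/
theorem rpow_le_of_variational {X G S M p q : ℝ} (hp : 2 ≤ p) (hpq : p.HolderConjugate q)
    (hX : 0 ≤ X) (hG : 0 ≤ G) (hS : 0 ≤ S) (hSM : S ^ q ≤ 2 ^ (q - 1) * M)
    (h : X ^ p ≤ X ^ (p - 1) * G + S * (X + G)) :
    X ^ p ≤ 3 * G ^ p + 6 * (p - 1) * M := by
  have hp0 : 0 < p := by linarith
  have hp1 : 0 < p - 1 := by linarith
  have hq0 := hpq.symm.pos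
  have hq1 : 0 ≤ q - 1 := by linarith [hpq.symm.lt]
  have hqp : p / q = p - 1 := hpq.div_conj_eq_sub_one
  have hqq : (q - 1) * (p - 1) = 1 := by
    linear_combination hpq.mul_eq_add
  have hq2 : q - 1 ≤ 1 := by nlinarith
  -- Multiplied by `p`, the Young terms cost `κ * (p - 1)` from `X ^ (p - 1) * G` and `1 / 2` from
  -- `X * S` as coefficients of `X ^ p`. This `κ` makes them sum to `p - 1`, so exactly one `X ^ p`
  -- survives on the left.
  set κ : ℝ := 1 - 1 / 2 / (p - 1) with hκ
  have hκ' : κ * (p - 1) = p - 1 - 1 / 2 := by rw [hκ]; field_simp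
  have hhalf : 1 / 2 / (p - 1) ≤ 1 / 2 := by
    rw [div_le_iff₀ hp1]; linarith
  have hκ0 : 0 < κ := by linarith
  -- Bernoulli's inequality with exponent `p - 1 ≥ 1`.
  have hκpow : κ ^ (-(p - 1)) ≤ 2 := by
    have hB := one_add_mul_self_le_rpow_one_add (s := -(1 / 2 / (p - 1))) (p := p - 1)
      (by linarith) (by linarith)
    have : (1 : ℝ) / 2 ≤ κ ^ (p - 1) := by
      calc (1 : ℝ) / 2 = 1 + (p - 1) * -(1 / 2 / (p - 1)) := by field_simp; norm_num
        _ ≤ _ := hB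
        _ = _ := by rw [hκ]; ring_nf
    rw [Real.rpow_neg hκ0.le]
    exact inv_le_of_inv_le₀ (by norm_num) (by simpa using this)
  have h1 : X ^ (p - 1) * G ≤ κ * (X ^ p / q) + 2 * (G ^ p / p) := by
    have := mul_le_weighted_rpow_add hpq.symm (Real.rpow_nonneg hX (p - 1)) hG hκ0
    rw [← Real.rpow_mul hX, hpq.sub_one_mul_conj] at this
    refine this.trans ?_
    gcongr
  have h2 : X * S ≤ 1 / 2 * (X ^ p / p) + 2 ^ (q - 1) * (S ^ q / q) := by
    have := mul_le_weighted_rpow_add hpq hX hS (by norm_num : (0 : ℝ) < 1 / 2)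
    rwa [one_div, Real.inv_rpow (by norm_num), Real.rpow_neg (by norm_num), inv_inv,
      ← one_div] at this
  have h3 : G * S ≤ G ^ p / p + S ^ q / q := by
    have := mul_le_weighted_rpow_add hpq hG hS one_pos
    simpa using this
  set x := X ^ p
  set g := G ^ p
  set σ := S ^ q
  have hσ : 0 ≤ σ := Real.rpow_nonneg hS q
  set z : ℝ := 2 ^ (q - 1)
  have hz1 : 1 ≤ z := Real.one_le_rpow (by norm_num) hq1
  have hz2 : z ≤ 2 := by
    calc z ≤ 2 ^ (1 : ℝ) := Real.rpow_le_rpow_of_exponent_le (by norm_num) hq2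
      _ = 2 := Real.rpow_one _
  have hM : 0 ≤ M := by nlinarith
  have h4 : p * x ≤ κ * (p - 1) * x + 2 * g + 1 / 2 * x + z * ((p - 1) * σ) + g + (p - 1) * σ := by
    have e : x ≤ κ * (x / q) + 2 * (g / p) + (1 / 2 * (x / p) + z * (σ / q)) +
        (g / p + σ / q) := by linarith
    have e2 := mul_le_mul_of_nonneg_left e hp0.le
    have r1 : p * (g / p) = g := by field_simp
    have r2 : p * (x / p) = x := by field_simp
    have r3 : p * (x / q) = (p - 1) * x := by rw [← hqp]; ring
    have r4 : p * (σ / q) = (p - 1) * σ := by rw [← hqp]; ring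
    linear_combination e2 + κ * r3 + 3 * r1 + 1 / 2 * r2 + (z + 1) * r4
  rw [hκ'] at h4
  have h5 : x ≤ 3 * g + (p - 1) * ((z + 1) * σ) := by linarith
  have h6 : (z + 1) * σ ≤ 6 * M := by
    calc (z + 1) * σ ≤ (z + 1) * (z * M) := by gcongr
      _ ≤ (2 + 1) * (2 * M) := by gcongr
      _ = 6 * M := by ring
  have h7 := mul_le_mul_of_nonneg_left h6 hp1.le
  linarith

/-- The first-order condition obtained by comparing `t = 0` with small positive `t`. -/
theorem rpow_le_of_min {X G l p : ℝ} (hp : 1 < p) (hX : 0 ≤ X)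
    (h : ∀ t ∈ Set.Ioo (0 : ℝ) 1, 1 / p * X ^ p - l ≤
      1 / p * ((1 - t) * X + t * G) ^ p - (1 - t) * l) :
    X ^ p ≤ X ^ (p - 1) * G + l := by
  have hp0 : 0 < p := by linarith
  have hd : HasDerivAt (fun t : ℝ => 1 / p * ((1 - t) * X + t * G) ^ p - (1 - t) * l)
      (X ^ (p - 1) * (G - X) + l) 0 := by
    have h1 : HasDerivAt (fun t : ℝ => (1 - t) * X + t * G) (G - X) 0 := by
      have := (((hasDerivAt_id (0 : ℝ)).const_sub 1).mul_const X).add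
        ((hasDerivAt_id (0 : ℝ)).mul_const G)
      convert! this using 1
      ring
    have h2 := (h1.rpow_const (p := p) (Or.inr hp.le)).const_mul (1 / p)
    have h3 := ((hasDerivAt_id (0 : ℝ)).const_sub 1).mul_const l
    convert! h2.sub h3 using 1
    simp
    field_simp
  have hlim := hd.tendsto_slope_zero_right
  have hnn : 0 ≤ X ^ (p - 1) * (G - X) + l := by
    refine ge_of_tendsto hlim ?_
    filter_upwards [Ioo_mem_nhdsGT (zero_lt_one' ℝ)] with t ht
    have := h t ht
    simp only [zero_add, sub_zero, one_mul, zero_mul, add_zero, smul_eq_mul]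
    exact mul_nonneg (inv_nonneg.2 ht.1.le) (by linarith)
  have hXX : X ^ (p - 1) * X = X ^ p := by
    rcases hX.eq_or_lt with rfl | hX
    · rw [Real.zero_rpow hp0.ne']; simp
    · rw [← Real.rpow_add_one hX.ne']; simp
  linarith

/-! ### Gradients of affine functions -/

/-- The gradient of an affine function. -/
noncomputable def affineGradient {d : ℕ} (A : E d →ᵃ[ℝ] ℝ) : E d :=
  (InnerProductSpace.toDual ℝ (E d)).symm A.linear.toContinuousLinearMap

theorem inner_affineGradient {d : ℕ} (A : E d →ᵃ[ℝ] ℝ) (y : E d) :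
    inner ℝ (affineGradient A) y = A.linear y := by
  simp [affineGradient]

theorem affine_sub_eq_inner {d : ℕ} (A : E d →ᵃ[ℝ] ℝ) (x y : E d) :
    A x - A y = inner ℝ (affineGradient A) (x - y) := by
  rw [inner_affineGradient, ← vsub_eq_sub x y, A.linearMap_vsub, vsub_eq_sub]

theorem affine_eq_linear_add {d : ℕ} (A : E d →ᵃ[ℝ] ℝ) :
    (A : E d → ℝ) = fun y => A.linear.toContinuousLinearMap y + A 0 := by
  funext y
  have := A.linearMap_vsub y 0
  simp only [vsub_eq_sub, sub_zero] at this
  simp [this]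

theorem hasGradientAt_affine {d : ℕ} (A : E d →ᵃ[ℝ] ℝ) (x : E d) :
    HasGradientAt A (affineGradient A) x := by
  rw [hasGradientAt_iff_hasFDerivAt, affineGradient, LinearIsometryEquiv.apply_symm_apply,
    affine_eq_linear_add]
  exact (ContinuousLinearMap.hasFDerivAt _).add_const _

theorem hasGradientAt_of_eqOn {d : ℕ} {A : E d →ᵃ[ℝ] ℝ} {v : E d → ℝ} {s : Set (E d)}
    (h : Set.EqOn v A s) {x : E d} (hx : x ∈ interior s) :
    HasGradientAt v (affineGradient A) x :=
  (hasGradientAt_affine A x).congr_of_eventuallyEq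
    (Filter.eventually_of_mem (mem_interior_iff_mem_nhds.1 hx) h)

theorem measurable_gradient {d : ℕ} (v : E d → ℝ) : Measurable (gradient v) :=
  (InnerProductSpace.toDual ℝ (E d)).symm.continuous.measurable.comp (measurable_fderiv ℝ v)

/-! ### Geometry of triangulations -/

section Triangulation

variable {d : ℕ} {K : Geometry.SimplicialComplex ℝ (E d)} {Ω : Set (E d)}

theorem isCompact_hull (t : Finset (E d)) : IsCompact (convexHull ℝ (t : Set (E d))) :=
  t.finite_toSet.isCompact_convexHull ℝ

namespace IsTriangulation

theorem finite_elements (hK : IsTriangulation K Ω) : (elements K).Finite :=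
  hK.finite.subset fun _ ht => ht.1

theorem isOpen (hK : IsTriangulation K Ω) : IsOpen Ω := by
  rw [← hK.interior_eq]
  exact isOpen_interior

theorem isCompact_space (hK : IsTriangulation K Ω) : IsCompact K.space :=
  hK.finite.isCompact_biUnion fun t _ => isCompact_hull t

theorem isCompact_closure (hK : IsTriangulation K Ω) : IsCompact (closure Ω) :=
  hK.space_eq ▸ hK.isCompact_space

theorem volume_lt_top (hK : IsTriangulation K Ω) : volume Ω < ⊤ :=
  (measure_mono subset_closure).trans_lt hK.isCompact_closure.measure_lt_top

theorem isFiniteMeasure (hK : IsTriangulation K Ω) : IsFiniteMeasure (volume.restrict Ω) :=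
  ⟨by simpa using hK.volume_lt_top⟩

theorem exists_mem_hull (hK : IsTriangulation K Ω) {x : E d} (hx : x ∈ closure Ω) :
    ∃ t ∈ elements K, x ∈ convexHull ℝ (t : Set (E d)) := by
  rw [← hK.space_eq, Geometry.SimplicialComplex.mem_space_iff] at hx
  obtain ⟨s, hs, hxs⟩ := hx
  obtain ⟨t, ht, hst, hcard⟩ := hK.pure s hs
  exact ⟨t, ⟨ht, hcard⟩, convexHull_mono (Finset.coe_subset.2 hst) hxs⟩

theorem hull_subset (hK : IsTriangulation K Ω) {t : Finset (E d)} (ht : t ∈ elements K) :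
    convexHull ℝ (t : Set (E d)) ⊆ closure Ω := by
  rw [← hK.space_eq]
  exact Geometry.SimplicialComplex.convexHull_subset_space ht.1

theorem interior_hull_subset (hK : IsTriangulation K Ω) {t : Finset (E d)}
    (ht : t ∈ elements K) : interior (convexHull ℝ (t : Set (E d))) ⊆ Ω := by
  rw [← hK.interior_eq]
  exact interior_mono (hK.hull_subset ht)

/-- Frontiers of convex sets are null and there are finitely many elements, so the skeleton can be
ignored in every integral. -/
theorem ae_mem_interior_hull (hK : IsTriangulation K Ω) :
    ∀ᵐ x : E d, x ∈ closure Ω → ∃ t ∈ elements K, x ∈ interior (convexHull ℝ (t : Set (E d))) := by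
  have h : ∀ᵐ x : E d, ∀ t ∈ elements K, x ∉ frontier (convexHull ℝ (t : Set (E d))) := by
    rw [ae_ball_iff hK.finite_elements.countable]
    exact fun t _ => measure_eq_zero_iff_ae_notMem.1
      ((convex_convexHull ℝ (t : Set (E d))).addHaar_frontier volume)
  filter_upwards [h] with x hx hxΩ
  obtain ⟨t, ht, hxt⟩ := hK.exists_mem_hull hxΩ
  refine ⟨t, ht, ?_⟩
  by_contra hcon
  exact hx t ht ⟨subset_closure hxt, hcon⟩

end IsTriangulation

/-- The `d + 1` affinely independent vertices form an affine basis, whose centroid is interior to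
the hull. Hence the gradient at the midpoint is the constant gradient of the element. -/
theorem midpt_mem_interior {t : Finset (E d)} (ht : t ∈ elements K) :
    midpt t ∈ interior (convexHull ℝ (t : Set (E d))) := by
  have hind := K.indep ht.1
  have hcard : Fintype.card t = Module.finrank ℝ (E d) + 1 := by
    simpa using ht.2
  let b : AffineBasis t ℝ (E d) :=
    ⟨(↑), hind, (hind.affineSpan_eq_top_iff_card_eq_finrank_add_one).2 hcard⟩
  have hb : (b : t → E d) = ((↑) : t → E d) := rfl
  have h := b.centroid_mem_interior_convexHull
  rw [hb, Subtype.range_coe] at h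
  rw [midpt, ← Finset.centroid_univ]
  exact h

/-! ### Piecewise linear functions and their weak gradients -/

namespace IsPiecewiseLinear

variable {u v : E d → ℝ}

theorem add (hu : IsPiecewiseLinear K u) (hv : IsPiecewiseLinear K v) :
    IsPiecewiseLinear K (u + v) := by
  refine ⟨hu.1.add hv.1, fun t ht => ?_⟩
  obtain ⟨A, hA⟩ := hu.2 t ht
  obtain ⟨B, hB⟩ := hv.2 t ht
  exact ⟨A + B, fun x hx => by simp [hA hx, hB hx]⟩

theorem const_smul (hu : IsPiecewiseLinear K u) (c : ℝ) : IsPiecewiseLinear K (c • u) := by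
  refine ⟨hu.1.const_smul c, fun t ht => ?_⟩
  obtain ⟨A, hA⟩ := hu.2 t ht
  exact ⟨c • A, fun x hx => by simp [hA hx]⟩

theorem differentiableAt (hu : IsPiecewiseLinear K u) {t : Finset (E d)} (ht : t ∈ elements K)
    {x : E d} (hx : x ∈ interior (convexHull ℝ (t : Set (E d)))) : DifferentiableAt ℝ u x := by
  obtain ⟨A, hA⟩ := hu.2 t ht
  exact (hasGradientAt_of_eqOn hA hx).differentiableAt

theorem gradient_eq_midpt (hu : IsPiecewiseLinear K u) {t : Finset (E d)} (ht : t ∈ elements K)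
    {x : E d} (hx : x ∈ interior (convexHull ℝ (t : Set (E d)))) :
    gradient u x = gradient u (midpt t) := by
  obtain ⟨A, hA⟩ := hu.2 t ht
  rw [(hasGradientAt_of_eqOn hA hx).gradient,
    (hasGradientAt_of_eqOn hA (midpt_mem_interior ht)).gradient]

theorem ae_differentiableAt (hK : IsTriangulation K Ω) (hu : IsPiecewiseLinear K u) :
    ∀ᵐ x : E d, x ∈ closure Ω → DifferentiableAt ℝ u x := by
  filter_upwards [hK.ae_mem_interior_hull] with x hx hxΩ
  obtain ⟨t, ht, hxt⟩ := hx hxΩ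
  exact hu.differentiableAt ht hxt

theorem aestronglyMeasurable (hK : IsTriangulation K Ω) (hu : IsPiecewiseLinear K u) :
    AEStronglyMeasurable u (volume.restrict Ω) :=
  (hu.1.mono (hK.space_eq ▸ subset_closure)).aestronglyMeasurable hK.isOpen.measurableSet

theorem memLp (hK : IsTriangulation K Ω) (hu : IsPiecewiseLinear K u) (p : ℝ≥0∞) :
    MemLp u p (volume.restrict Ω) := by
  have := hK.isFiniteMeasure
  obtain ⟨C, hC⟩ := hK.isCompact_space.exists_bound_of_continuousOn hu.1
  refine MemLp.of_bound (hu.aestronglyMeasurable hK) C ?_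
  filter_upwards [self_mem_ae_restrict hK.isOpen.measurableSet] with x hx
  exact hC x (hK.space_eq ▸ subset_closure hx)

theorem memLp_gradient (hK : IsTriangulation K Ω) (hu : IsPiecewiseLinear K u) (p : ℝ≥0∞) :
    MemLp (gradient u) p (volume.restrict Ω) := by
  have := hK.isFiniteMeasure
  obtain ⟨C, hC⟩ := (hK.finite_elements.image fun t => ‖gradient u (midpt t)‖).bddAbove
  refine MemLp.of_bound (measurable_gradient u).aestronglyMeasurable C ?_
  filter_upwards [self_mem_ae_restrict hK.isOpen.measurableSet,
    ae_restrict_of_ae hK.ae_mem_interior_hull] with x hx hx'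
  obtain ⟨t, ht, hxt⟩ := hx' (subset_closure hx)
  rw [hu.gradient_eq_midpt ht hxt]
  exact hC ⟨t, ht, rfl⟩

/-- A piecewise linear function, times a smooth function supported in `Ω`, is Lipschitz. -/
theorem lipschitzWith_mul (hK : IsTriangulation K Ω) (hu : IsPiecewiseLinear K u)
    {φ : E d → ℝ} (hφ : ContDiff ℝ ∞ φ) (hφc : HasCompactSupport φ) (hφΩ : tsupport φ ⊆ Ω) :
    ∃ C : NNReal, LipschitzWith C (fun x => u x * φ x) := by
  have hloc : ∀ t ∈ elements K, ∃ C : NNReal, LipschitzOnWith C (fun x => u x * φ x)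
      (convexHull ℝ (t : Set (E d))) := by
    intro t ht
    obtain ⟨A, hA⟩ := hu.2 t ht
    have hAs : ContDiff ℝ ∞ (A : E d → ℝ) := by
      rw [affine_eq_linear_add]
      exact (ContinuousLinearMap.contDiff _).add contDiff_const
    obtain ⟨C, hC⟩ := ContDiff.lipschitzWith_of_hasCompactSupport (𝕂 := ℝ)
      (hφc.mul_left (f := (A : E d → ℝ))) (hAs.mul hφ) (by simp)
    refine ⟨C, fun x hx y hy => ?_⟩
    simpa [hA hx, hA hy] using hC x y
  choose! C hC using hloc
  obtain ⟨B, hB⟩ := (hK.finite_elements.image C).bddAbove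
  refine ⟨B, LipschitzWith.of_dist_le_mul fun x y => ?_⟩
  have hzero : ∀ z, z ∉ Ω → u z * φ z = 0 := fun z hz => by
    rw [image_eq_zero_of_notMem_tsupport fun h => hz (hφΩ h), mul_zero]
  let γ : ℝ → E d := fun s => AffineMap.lineMap y x s
  have hγ : Continuous γ := AffineMap.lineMap_continuous
  -- The segment may leave `Ω`, so the complement of `Ω`, where the product vanishes, joins the
  -- cover as the index `none`.
  let F : Option (Finset (E d)) → Set ℝ := fun o =>
    o.elim (γ ⁻¹' Ωᶜ) fun t => γ ⁻¹' convexHull ℝ (t : Set (E d))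
  have hF : ∀ o, IsClosed (F o) := by
    rintro (_ | t)
    · exact hK.isOpen.isClosed_compl.preimage hγ
    · exact (isCompact_hull t).isClosed.preimage hγ
  have := abs_sub_le_of_finite_closed_cover hF (f := fun s => u (γ s) * φ (γ s))
    (C := B * dist x y) (Finset.insertNone hK.finite_elements.toFinset) ?_ zero_le_one ?_
  · simpa [γ, Real.dist_eq] using this
  · rintro (_ | t) ho a ha b hb
    · rw [hzero _ ha, hzero _ hb]
      simp only [sub_self, abs_zero]
      positivity
    · have ht : t ∈ elements K := by simpa using ho
      have h1 := (hC t ht).dist_le_mul _ ha _ hb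
      have h2 : dist (γ a) (γ b) = |a - b| * dist x y := by
        simp [γ, dist_lineMap_lineMap, Real.dist_eq, dist_comm x y]
      rw [Real.dist_eq, h2] at h1
      refine h1.trans ?_
      have h3 : (C t : ℝ) ≤ B := by exact_mod_cast hB ⟨t, ht, rfl⟩
      calc (C t : ℝ) * (|a - b| * dist x y) ≤ B * (|a - b| * dist x y) := by gcongr
        _ = _ := by ring
  · intro s _
    by_cases hs : γ s ∈ Ω
    · obtain ⟨t, ht, hst⟩ := hK.exists_mem_hull (subset_closure hs)
      simp only [Set.mem_iUnion]
      exact ⟨some t, by simpa using ht, hst⟩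
    · simp only [Set.mem_iUnion]
      exact ⟨none, by simp, hs⟩

/-- `u * φ` is Lipschitz with compact support, so each of its directional derivatives integrates to
zero; almost everywhere the product rule splits that derivative into the two required terms. -/
theorem hasWeakGradient (hK : IsTriangulation K Ω) (hu : IsPiecewiseLinear K u) :
    HasWeakGradient Ω u (gradient u) := by
  have := hK.isFiniteMeasure
  have hi : Integrable u (volume.restrict Ω) := memLp_one_iff_integrable.1 (hu.memLp hK 1)
  have hgi : Integrable (gradient u) (volume.restrict Ω) :=
    memLp_one_iff_integrable.1 (hu.memLp_gradient hK 1)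
  refine ⟨IntegrableOn.locallyIntegrableOn hi, IntegrableOn.locallyIntegrableOn hgi,
    fun φ hφ hφc hφΩ => ?_⟩
  have hgradφ : Continuous (gradient φ) :=
    (InnerProductSpace.toDual ℝ (E d)).symm.continuous.comp
      (hφ.continuous_fderiv (by simp))
  have hgradφc : HasCompactSupport (gradient φ) := (hφc.fderiv ℝ).comp_left
    (g := (InnerProductSpace.toDual ℝ (E d)).symm) (map_zero _)
  obtain ⟨M, hM⟩ := hφc.exists_bound_of_continuous hφ.continuous
  obtain ⟨M', hM'⟩ := hgradφc.exists_bound_of_continuous hgradφ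
  have hi1 : Integrable (fun x => u x • gradient φ x) (volume.restrict Ω) :=
    hi.smul_bdd M' hgradφ.aestronglyMeasurable (.of_forall hM')
  have hi2 : Integrable (fun x => φ x • gradient u x) (volume.restrict Ω) :=
    hgi.bdd_smul M hφ.continuous.aestronglyMeasurable (.of_forall hM)
  rw [eq_neg_iff_add_eq_zero, ← integral_add hi1 hi2]
  obtain ⟨C, hC⟩ := hu.lipschitzWith_mul hK hφ hφc hφΩ
  refine ext_inner_left ℝ fun e => ?_
  have hinner := integral_inner (𝕜 := ℝ) (hi1.add hi2) e
  simp only [Pi.add_apply] at hinner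
  rw [inner_zero_right, ← hinner]
  -- Integration by parts against the constant `1`, whose derivative vanishes.
  have hz := (LipschitzWith.const (1 : ℝ)).integral_lineDeriv_mul_eq (μ := volume) hC
    (hφc.mul_left (f := u)) (-e)
  simp only [neg_neg, mul_one] at hz
  have hc : ∀ x : E d, lineDeriv ℝ (fun _ : E d => (1 : ℝ)) x (-e) = 0 := fun x => by
    simp [lineDeriv]
  simp only [hc, zero_mul, integral_zero] at hz
  have hout : ∀ x, x ∉ Ω → lineDeriv ℝ (fun x => u x * φ x) x e = 0 := by
    intro x hx
    have hev : (fun x => u x * φ x) =ᶠ[nhds x] fun _ => (0 : ℝ) := by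
      filter_upwards [(isClosed_tsupport φ).isOpen_compl.mem_nhds fun h => hx (hφΩ h)] with y hy
      rw [image_eq_zero_of_notMem_tsupport hy, mul_zero]
    rw [hev.lineDeriv_eq]
    simp [lineDeriv]
  rw [← setIntegral_eq_integral_of_forall_compl_eq_zero hout] at hz
  rw [hz]
  refine integral_congr_ae ?_
  filter_upwards [self_mem_ae_restrict hK.isOpen.measurableSet,
    ae_restrict_of_ae (hu.ae_differentiableAt hK)] with x hx hux
  have hd := hux (subset_closure hx)
  have hdφ : DifferentiableAt ℝ φ x := hφ.differentiable (by simp) x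
  rw [(hd.fun_mul hdφ).lineDeriv_eq_fderiv, fderiv_fun_mul hd hdφ]
  simp [inner_add_right, inner_smul_right, inner_gradient_right]

end IsPiecewiseLinear

end Triangulation

/-! ### Slicing along lines and the Friedrichs inequality on `Ω` -/

/-- Integration over space as an average of the integrals over the lines of a given direction. -/
theorem lintegral_eq_lintegral_lines {d : ℕ} {e : E d} (he : ‖e‖ = 1) {ψ : E d → ℝ≥0∞}
    (hψ : Measurable ψ) :
    ∫⁻ y, ψ y = ∫⁻ x in {x : E d | inner ℝ e x ∈ Set.Icc (0 : ℝ) 1}, ∫⁻ s : ℝ, ψ (x + s • e) := by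
  -- A slab of thickness one: for each `y` the parameters `s` with `y - s • e ∈ T` form an interval
  -- of length one, so Tonelli and translation invariance count every point with weight one.
  set T : Set (E d) := {x : E d | inner ℝ e x ∈ Set.Icc (0 : ℝ) 1} with hTdef
  have hTm : MeasurableSet T :=
    measurableSet_Icc.preimage (Continuous.measurable (by fun_prop))
  have hχ : Measurable (T.indicator (fun _ => (1 : ℝ≥0∞))) := measurable_const.indicator hTm
  have hmeas : Measurable (fun z : E d × ℝ => ψ (z.1 + z.2 • e)) :=
    hψ.comp (Continuous.measurable (by fun_prop))
  have hmeas' : Measurable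
      (fun z : E d × ℝ => T.indicator (fun _ => (1 : ℝ≥0∞)) (z.1 - z.2 • e) * ψ z.1) :=
    (hχ.comp (Continuous.measurable (by fun_prop))).mul (hψ.comp measurable_fst)
  symm
  calc ∫⁻ x in T, ∫⁻ s : ℝ, ψ (x + s • e)
      = ∫⁻ x, ∫⁻ s : ℝ, T.indicator (fun _ => 1) x * ψ (x + s • e) := by
        rw [← lintegral_indicator hTm]
        refine lintegral_congr fun x => ?_
        by_cases hx : x ∈ T <;> simp [hx]
    _ = ∫⁻ s : ℝ, ∫⁻ x, T.indicator (fun _ => 1) x * ψ (x + s • e) :=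
        lintegral_lintegral_swap ((hχ.comp measurable_fst).mul hmeas).aemeasurable
    _ = ∫⁻ s : ℝ, ∫⁻ y, T.indicator (fun _ => 1) (y - s • e) * ψ y := by
        refine lintegral_congr fun s => ?_
        rw [← lintegral_add_right_eq_self
          (fun y => T.indicator (fun _ => 1) (y - s • e) * ψ y) (s • e)]
        simp
    _ = ∫⁻ y, ∫⁻ s : ℝ, T.indicator (fun _ => 1) (y - s • e) * ψ y :=
        (lintegral_lintegral_swap hmeas'.aemeasurable).symm
    _ = ∫⁻ y, ψ y := by
        refine lintegral_congr fun y => ?_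
        have hχy : Measurable fun s : ℝ => T.indicator (fun _ => (1 : ℝ≥0∞)) (y - s • e) :=
          hχ.comp (Continuous.measurable (by fun_prop))
        rw [lintegral_mul_const _ hχy]
        have h1 : (fun s : ℝ => T.indicator (fun _ => (1 : ℝ≥0∞)) (y - s • e)) =
            (Set.Icc (inner ℝ e y - 1) (inner ℝ e y)).indicator (fun _ => 1) := by
          funext s
          have : y - s • e ∈ T ↔ s ∈ Set.Icc (inner ℝ e y - 1) (inner ℝ e y) := by
            simp only [hTdef, Set.mem_ofPred_eq, inner_sub_right, inner_smul_right,
              real_inner_self_eq_norm_sq, he, Set.mem_Icc]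
            constructor <;> rintro ⟨h1, h2⟩ <;> constructor <;> linarith
          by_cases hs : y - s • e ∈ T
          · rw [Set.indicator_of_mem hs, Set.indicator_of_mem (this.1 hs)]
          · rw [Set.indicator_of_notMem hs, Set.indicator_of_notMem fun h => hs (this.2 h)]
        rw [h1, lintegral_indicator measurableSet_Icc]
        simp

theorem ae_ae_lines {d : ℕ} (e : E d) {P : E d → Prop} (h : ∀ᵐ y, P y) :
    ∀ᵐ x : E d, ∀ᵐ s : ℝ, P (x + s • e) := by
  -- The set where `P` fails need not be measurable, so it is replaced by a measurable null
  -- superset.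
  have hm := (measurableSet_toMeasurable volume {y : E d | ¬ P y}).compl
  have h2 : ∀ᵐ y : E d, y ∈ (toMeasurable volume {y : E d | ¬ P y})ᶜ := by
    rw [ae_iff]
    simpa [measure_toMeasurable] using ae_iff.1 h
  have h3 := (ae_ae_add_linearMap_mem_iff (LinearMap.toSpanSingleton ℝ (E d) e) volume volume
    hm).2 h2
  filter_upwards [h3] with x hx
  filter_upwards [hx] with s hs
  by_contra hcon
  exact hs (subset_toMeasurable _ _ (by simpa using hcon))

section

variable {d : ℕ} {K : Geometry.SimplicialComplex ℝ (E d)} {Ω Γ : Set (E d)}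

theorem IsPiecewiseLinear.exists_lipschitz_lines {v : E d → ℝ} (hK : IsTriangulation K Ω)
    (hv : IsPiecewiseLinear K v) {e : E d} (he : ‖e‖ = 1) :
    ∃ C : ℝ, ∀ (x : E d) (r s : ℝ), r ≤ s → (∀ y ∈ Set.Icc r s, x + y • e ∈ closure Ω) →
      |v (x + s • e) - v (x + r • e)| ≤ C * (s - r) := by
  choose! A hA using hv.2
  obtain ⟨C, hC⟩ := (hK.finite_elements.image fun t => ‖affineGradient (A t)‖).bddAbove
  refine ⟨C, fun x r s hrs hseg => ?_⟩
  refine abs_sub_le_of_finite_closed_cover (f := fun s => v (x + s • e))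
    (F := fun t : Finset (E d) => (fun s : ℝ => x + s • e) ⁻¹' convexHull ℝ (t : Set (E d)))
    (fun t => (isCompact_hull t).isClosed.preimage (by fun_prop))
    hK.finite_elements.toFinset ?_ hrs ?_
  · intro t ht a ha b hb
    have ht : t ∈ elements K := by simpa using ht
    have h1 : x + a • e - (x + b • e) = (a - b) • e := by rw [sub_smul]; abel
    change |v (x + a • e) - v (x + b • e)| ≤ _
    rw [hA t ht ha, hA t ht hb, affine_sub_eq_inner, h1]
    calc |inner ℝ (affineGradient (A t)) ((a - b) • e)|
        ≤ ‖affineGradient (A t)‖ * ‖(a - b) • e‖ := abs_real_inner_le_norm _ _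
      _ = ‖affineGradient (A t)‖ * |a - b| := by rw [norm_smul, he, mul_one, Real.norm_eq_abs]
      _ ≤ C * |a - b| := by
          gcongr
          exact hC ⟨t, ht, rfl⟩
  · intro y hy
    obtain ⟨t, ht, hyt⟩ := hK.exists_mem_hull (hseg y hy)
    simp only [Set.mem_iUnion]
    exact ⟨t, by simpa using ht, hyt⟩

theorem enorm_deriv_line_le {v : E d → ℝ} {x e : E d} {s : ℝ} (he : ‖e‖ = 1)
    (hv : DifferentiableAt ℝ v (x + s • e)) :
    ‖deriv (fun s : ℝ => v (x + s • e)) s‖ₑ ≤ ‖gradient v (x + s • e)‖ₑ := by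
  have h1 : HasDerivAt (fun s : ℝ => x + s • e) e s := by
    simpa using ((hasDerivAt_id s).smul_const e).const_add x
  have h2 := hv.hasFDerivAt.comp_hasDerivAt s h1
  have h3 : deriv (fun s : ℝ => v (x + s • e)) s = inner ℝ (gradient v (x + s • e)) e := by
    rw [inner_gradient_left]
    exact h2.deriv
  rw [h3, enorm_le_iff_norm_le]
  simpa [he] using norm_inner_le_norm (𝕜 := ℝ) (gradient v (x + s • e)) e

/-- The Friedrichs inequality with the width in a direction seeing the Dirichlet boundary. -/
theorem lintegral_rpow_le_of_hasDirichletWidth {v : E d → ℝ} {w p : ℝ}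
    (hK : IsTriangulation K Ω) (hp : 1 < p) (hv : v ∈ feSpace K Ω Γ)
    (hw : HasDirichletWidth Ω Γ w) :
    ∫⁻ x in Ω, ‖v x‖ₑ ^ p ≤ ENNReal.ofReal (w ^ p / p) * ∫⁻ x in Ω, ‖gradient v x‖ₑ ^ p := by
  obtain ⟨e, he, ⟨a, ha⟩, hend⟩ := hw
  obtain ⟨hv, hv0⟩ := hv
  have hΩm := hK.isOpen.measurableSet
  -- `v` is arbitrary away from `K.space`, so only its cut-off to `Ω` is known to be measurable.
  have hvm : Measurable (Ω.indicator v) := by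
    classical
    rw [← Set.piecewise_eq_indicator]
    exact (hv.1.mono (hK.space_eq ▸ subset_closure)).measurable_piecewise continuousOn_const hΩm
  have hψ1 : Measurable (Ω.indicator fun y => ‖v y‖ₑ ^ p) := by
    have : (Ω.indicator fun y => ‖v y‖ₑ ^ p) = fun y => ‖Ω.indicator v y‖ₑ ^ p := by
      funext y
      by_cases hy : y ∈ Ω
      · simp [hy]
      · simp [hy, ENNReal.zero_rpow_of_pos (zero_lt_one.trans hp)]
    rw [this]
    exact hvm.enorm.pow_const p
  have hψ2 : Measurable (Ω.indicator fun y => ‖gradient v y‖ₑ ^ p) :=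
    ((measurable_gradient v).enorm.pow_const p).indicator hΩm
  rw [← lintegral_indicator hΩm, ← lintegral_indicator hΩm, lintegral_eq_lintegral_lines he hψ1,
    lintegral_eq_lintegral_lines he hψ2, ← lintegral_const_mul']
  swap
  · exact ENNReal.ofReal_ne_top
  obtain ⟨C, hC⟩ := hv.exists_lipschitz_lines hK he
  refine lintegral_mono_ae (ae_restrict_of_ae ?_)
  filter_upwards [ae_ae_lines e ((ae_restrict_iff' hΩm).1 hend),
    ae_ae_lines e (hv.ae_differentiableAt hK)] with x hx1 hx2
  set D : Set ℝ := (fun s : ℝ => x + s • e) ⁻¹' Ω with hDdef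
  have hγ : Continuous fun s : ℝ => x + s • e := by fun_prop
  have hD : IsOpen D := hK.isOpen.preimage hγ
  have hind : ∀ ψ : E d → ℝ≥0∞, ∫⁻ s : ℝ, Ω.indicator ψ (x + s • e) =
      ∫⁻ s in D, ψ (x + s • e) := by
    intro ψ
    rw [← lintegral_indicator hD.measurableSet]
    rfl
  rw [hind, hind]
  have hline := lintegral_rpow_le_of_isOpen (F := fun s => v (x + s • e)) (D := D)
    (a := a - inner ℝ e x) (w := w) (C := C) hp hD ?_ ?_ ?_
  · refine hline.trans (mul_le_mul' le_rfl (lintegral_mono_ae ?_))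
    filter_upwards [self_mem_ae_restrict hD.measurableSet, ae_restrict_of_ae hx2] with s hs hds
    have := enorm_deriv_line_le he (hds (subset_closure hs))
    gcongr
  · intro s hs
    have := ha _ hs
    simp only [inner_add_right, inner_smul_right, real_inner_self_eq_norm_sq, he] at this
    constructor <;> linarith [this.1, this.2]
  · intro r s hrs hseg
    exact hC x r s hrs fun y hy => hγ.closure_preimage_subset Ω (hseg hy)
  · filter_upwards [hx1] with s hs hsD
    obtain ⟨t, ⟨ht1, ht2⟩, ht3⟩ := hs hsD
    have hst : x + (s + t) • e = x + s • e + t • e := by rw [add_smul, add_assoc]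
    refine ⟨t, ?_, ?_, ?_⟩
    · rw [hst]
      exact hv0 _ ⟨ht1, ht2⟩
    · intro hmem
      rw [hDdef, Set.mem_preimage, hst] at hmem
      rw [hK.isOpen.frontier_eq] at ht1
      exact ht1.2 hmem
    · rintro _ ⟨b, c, hb, hc, hbc, rfl⟩
      refine ht3 ⟨b, c, hb, hc, hbc, ?_⟩
      have : b = 1 - c := by linarith
      subst this
      simp only [smul_eq_mul]
      module

theorem friedrichsLength_le_of_hasDirichletWidth {w p : ℝ} (hK : IsTriangulation K Ω)
    (hp : 1 < p) (hw : HasDirichletWidth Ω Γ w) :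
    friedrichsLength K Ω Γ p ≤ ENNReal.ofReal w := by
  -- For empty `Ω` the width `w` may be negative.
  rcases Ω.eq_empty_or_nonempty with rfl | ⟨x, hx⟩
  · exact sInf_le fun v _ => by simp
  have hw0 : 0 ≤ w := by
    obtain ⟨e, -, ⟨a, ha⟩, -⟩ := hw
    linarith [(ha x hx).1, (ha x hx).2]
  refine sInf_le fun v hv => ?_
  have hp0 : 0 < p := by linarith
  have h := lintegral_rpow_le_of_hasDirichletWidth hK hp hv hw
  rw [eLpNorm_eq_lintegral_rpow_enorm_toReal (by simpa using hp0) (by simp),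
    eLpNorm_eq_lintegral_rpow_enorm_toReal (by simpa using hp0) (by simp),
    ENNReal.toReal_ofReal hp0.le]
  calc _ ≤ (ENNReal.ofReal (w ^ p / p) * ∫⁻ x in Ω, ‖gradient v x‖ₑ ^ p) ^ (1 / p) := by gcongr
    _ = _ := by
      rw [ENNReal.mul_rpow_of_nonneg _ _ (by positivity),
        ENNReal.ofReal_rpow_of_nonneg (by positivity) (by positivity), ← ENNReal.ofReal_mul hw0]
      congr 2
      rw [Real.div_rpow (by positivity) hp0.le, ← Real.rpow_mul hw0, mul_one_div_cancel hp0.ne',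
        Real.rpow_one, Real.rpow_neg hp0.le, div_eq_mul_inv]

end

/-! ### Variational inequality and load estimate -/

/-- Shows that the best constants `friedrichsLength` and `traceConst` are themselves valid
constants. Finiteness of the infimum excludes an empty `S`, for which `⊤ * 0 = 0` would break the
bound at `y = 0`. -/
theorem le_sInf_mul {S : Set ℝ≥0∞} {x y : ℝ≥0∞} (hS : sInf S ≠ ⊤) (hy : y ≠ ⊤)
    (h : ∀ L ∈ S, x ≤ L * y) : x ≤ sInf S * y := by
  rcases eq_or_ne y 0 with rfl | hy0
  · obtain ⟨L, hL⟩ : S.Nonempty := Set.nonempty_iff_ne_empty.2 fun h0 => hS (by simp [h0])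
    simpa using h L hL
  · rw [← ENNReal.div_le_iff hy0 hy]
    exact le_sInf fun L hL => (ENNReal.div_le_iff hy0 hy).2 (h L hL)

theorem enorm_integral_mul_le {α : Type*} [MeasurableSpace α] {μ : Measure α} {p q : ℝ}
    (hpq : p.HolderConjugate q) {f u : α → ℝ} (hf : AEStronglyMeasurable f μ)
    (hu : AEStronglyMeasurable u μ) :
    ‖∫ x, f x * u x ∂μ‖ₑ ≤ eLpNorm f (ENNReal.ofReal q) μ * eLpNorm u (ENNReal.ofReal p) μ := by
  rw [eLpNorm_eq_lintegral_rpow_enorm_toReal (by simpa using hpq.symm.pos) (by simp),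
    eLpNorm_eq_lintegral_rpow_enorm_toReal (by simpa using hpq.pos) (by simp),
    ENNReal.toReal_ofReal hpq.pos.le, ENNReal.toReal_ofReal hpq.symm.pos.le]
  refine (enorm_integral_le_lintegral_enorm _).trans ?_
  simp only [enorm_mul]
  exact ENNReal.lintegral_mul_le_Lp_mul_Lq μ hpq.symm hf.enorm hu.enorm

theorem gradient_add {d : ℕ} {u v : E d → ℝ} {x : E d} (hu : DifferentiableAt ℝ u x)
    (hv : DifferentiableAt ℝ v x) : gradient (u + v) x = gradient u x + gradient v x := by
  simp [gradient, fderiv_add hu hv]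

theorem gradient_const_smul {d : ℕ} {u : E d → ℝ} {x : E d} (hu : DifferentiableAt ℝ u x)
    (c : ℝ) : gradient (c • u) x = c • gradient u x := by
  simp [gradient, fderiv_const_smul hu c]

section

variable {d : ℕ} {K : Geometry.SimplicialComplex ℝ (E d)} {Ω Γ : Set (E d)}

/-- The seminorm `‖∇v‖_{L^p(Ω)}` as a real number. -/
noncomputable def gradNorm (Ω : Set (E d)) (p : ℝ) (v : E d → ℝ) : ℝ :=
  (eLpNorm (gradient v) (ENNReal.ofReal p) (volume.restrict Ω)).toReal

theorem IsPiecewiseLinear.xNormPow_eq {v : E d → ℝ} {p : ℝ} (hK : IsTriangulation K Ω)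
    (hp : 0 < p) (hv : IsPiecewiseLinear K v) : xNormPow Ω p v = gradNorm Ω p v ^ p := by
  have h := (hv.memLp_gradient hK (ENNReal.ofReal p)).eLpNorm_eq_integral_rpow_norm
    (by simpa using hp) (by simp)
  have hnn : 0 ≤ ∫ x in Ω, ‖gradient v x‖ ^ p :=
    integral_nonneg fun x => Real.rpow_nonneg (norm_nonneg _) _
  rw [ENNReal.toReal_ofReal hp.le] at h
  rw [gradNorm, h, ENNReal.toReal_ofReal (Real.rpow_nonneg hnn _), ← Real.rpow_mul hnn,
    inv_mul_cancel₀ hp.ne', Real.rpow_one, xNormPow]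

theorem gradNorm_le_of_ae_eq {v a b : E d → ℝ} {p α β : ℝ} (hK : IsTriangulation K Ω)
    (hp : 1 ≤ p) (ha : IsPiecewiseLinear K a) (hb : IsPiecewiseLinear K b)
    (h : gradient v =ᵐ[volume.restrict Ω] α • gradient a + β • gradient b) :
    gradNorm Ω p v ≤ |α| * gradNorm Ω p a + |β| * gradNorm Ω p b := by
  have hma := ha.memLp_gradient hK (ENNReal.ofReal p)
  have hmb := hb.memLp_gradient hK (ENNReal.ofReal p)
  have h1 := eLpNorm_add_le (hma.const_smul α).1 (hmb.const_smul β).1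
    (p := ENNReal.ofReal p) (by simpa using hp)
  rw [eLpNorm_const_smul, eLpNorm_const_smul, ← eLpNorm_congr_ae h] at h1
  have h2 := ENNReal.toReal_mono (by
    simp [ENNReal.mul_eq_top, hma.eLpNorm_ne_top, hmb.eLpNorm_ne_top]) h1
  rw [ENNReal.toReal_add (by simp [ENNReal.mul_eq_top, hma.eLpNorm_ne_top])
    (by simp [ENNReal.mul_eq_top, hmb.eLpNorm_ne_top])] at h2
  simpa [gradNorm] using h2

theorem gradNorm_le_add {u g : E d → ℝ} {p : ℝ} (hK : IsTriangulation K Ω) (hp : 1 ≤ p)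
    (hu : IsPiecewiseLinear K u) (hg : IsPiecewiseLinear K g) :
    gradNorm Ω p u ≤ gradNorm Ω p (u + g) + gradNorm Ω p g := by
  have := gradNorm_le_of_ae_eq (v := u) (α := 1) (β := -1) hK hp (hu.add hg) hg ?_
  · simpa using this
  filter_upwards [self_mem_ae_restrict hK.isOpen.measurableSet,
    ae_restrict_of_ae (hu.ae_differentiableAt hK),
    ae_restrict_of_ae (hg.ae_differentiableAt hK)] with x hx h1 h2
  have hx := subset_closure hx
  simp [gradient_add (h1 hx) (h2 hx)]

theorem gradNorm_segment_le {u g : E d → ℝ} {p t : ℝ} (hK : IsTriangulation K Ω) (hp : 1 ≤ p)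
    (hu : IsPiecewiseLinear K u) (hg : IsPiecewiseLinear K g) (ht : t ∈ Set.Ioo (0 : ℝ) 1) :
    gradNorm Ω p ((1 - t) • u + g) ≤ (1 - t) * gradNorm Ω p (u + g) + t * gradNorm Ω p g := by
  have := gradNorm_le_of_ae_eq (v := (1 - t) • u + g) (α := 1 - t) (β := t) hK hp
    (hu.add hg) hg ?_
  · rwa [abs_of_pos ht.1, abs_of_pos (sub_pos.2 ht.2)] at this
  filter_upwards [self_mem_ae_restrict hK.isOpen.measurableSet,
    ae_restrict_of_ae (hu.ae_differentiableAt hK),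
    ae_restrict_of_ae (hg.ae_differentiableAt hK)] with x hx h1 h2
  have hx := subset_closure hx
  simp only [Pi.add_apply, Pi.smul_apply]
  rw [gradient_add ((h1 hx).const_smul _) (h2 hx), gradient_const_smul (h1 hx),
    gradient_add (h1 hx) (h2 hx)]
  module

theorem feSpace.const_smul {u : E d → ℝ} (hu : u ∈ feSpace K Ω Γ) (c : ℝ) :
    c • u ∈ feSpace K Ω Γ :=
  ⟨hu.1.const_smul c, fun x hx => by simp [hu.2 x hx]⟩

/-- The variational inequality satisfied by a minimizer. -/
theorem rpow_le_of_minimizer {p : ℝ} (hK : IsTriangulation K Ω) (hp : 1 < p)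
    {f g h u : E d → ℝ} (hg : IsPiecewiseLinear K g) (hu : u ∈ feSpace K Ω Γ)
    (hmin : ∀ v ∈ feSpace K Ω Γ, J Ω Γ p f g h u ≤ J Ω Γ p f g h v) :
    gradNorm Ω p (u + g) ^ p ≤ gradNorm Ω p (u + g) ^ (p - 1) * gradNorm Ω p g +
      (∫ x in Γ, h x * u x ∂(surf d) + ∫ x in Ω, f x * u x) := by
  have hp0 : 0 < p := by linarith
  refine rpow_le_of_min hp ENNReal.toReal_nonneg fun t ht => ?_
  have h1 := hmin _ (feSpace.const_smul hu (1 - t))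
  have h2 : ∀ (μ : Measure (E d)) (k : E d → ℝ),
      ∫ x, k x * ((1 - t) • u) x ∂μ = (1 - t) * ∫ x, k x * u x ∂μ := by
    intro μ k
    rw [← integral_const_mul]
    congr 1
    funext x
    simp only [Pi.smul_apply, smul_eq_mul]
    ring
  rw [J, J, h2, h2, (hu.1.add hg).xNormPow_eq hK hp0,
    ((hu.1.const_smul (1 - t)).add hg).xNormPow_eq hK hp0] at h1
  have h3 : 1 / p * gradNorm Ω p ((1 - t) • u + g) ^ p ≤
      1 / p * ((1 - t) * gradNorm Ω p (u + g) + t * gradNorm Ω p g) ^ p := by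
    have h0 : 0 ≤ gradNorm Ω p ((1 - t) • u + g) := ENNReal.toReal_nonneg
    have := gradNorm_segment_le hK hp.le hu.1 hg ht
    gcongr
  linarith

theorem eLpNorm_le_of_friedrichsLength_le {p : ℝ} {L : ℝ≥0∞} (hK : IsTriangulation K Ω)
    (hL : friedrichsLength K Ω Γ p ≤ L) (hLtop : L ≠ ⊤) {u : E d → ℝ}
    (hu : u ∈ feSpace K Ω Γ) :
    eLpNorm u (ENNReal.ofReal p) (volume.restrict Ω) ≤
      L * (ENNReal.ofReal (p ^ (-(1 / p))) *
        eLpNorm (gradient u) (ENNReal.ofReal p) (volume.restrict Ω)) := by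
  refine (le_sInf_mul (ne_top_of_le_ne_top hLtop hL) (ENNReal.mul_ne_top ENNReal.ofReal_ne_top
    (hu.1.memLp_gradient hK _).eLpNorm_ne_top) fun L' hL' => ?_).trans (mul_le_mul' hL le_rfl)
  rw [← mul_assoc]
  exact hL' u hu

theorem eLpNorm_frontier_le {p : ℝ} (hK : IsTriangulation K Ω) (hC : traceConst Ω p ≠ ⊤)
    {u : E d → ℝ} (hu : IsPiecewiseLinear K u) :
    eLpNorm u (ENNReal.ofReal p) ((surf d).restrict (frontier Ω)) ≤
      traceConst Ω p * (eLpNorm u (ENNReal.ofReal p) (volume.restrict Ω) +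
        eLpNorm (gradient u) (ENNReal.ofReal p) (volume.restrict Ω)) := by
  have h1 := hu.memLp hK (ENNReal.ofReal p)
  have h2 := hu.memLp_gradient hK (ENNReal.ofReal p)
  exact le_sInf_mul hC (ENNReal.add_ne_top.2 ⟨h1.eLpNorm_ne_top, h2.eLpNorm_ne_top⟩)
    fun C hC => hC u (gradient u) (hK.space_eq ▸ hu.1) h1 h2 (hu.hasWeakGradient hK)

/-- The load functional is bounded by the gradient norm. -/
theorem enorm_load_le {p q : ℝ} {L : ℝ≥0∞} (hK : IsTriangulation K Ω)
    (hΓ : Γ ⊆ frontier Ω) (hpq : p.HolderConjugate q) (hL : friedrichsLength K Ω Γ p ≤ L)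
    {f h u : E d → ℝ} (hf : MemLp f (ENNReal.ofReal q) (volume.restrict Ω))
    (hh : MemLp h (ENNReal.ofReal q) ((surf d).restrict Γ)) (hu : u ∈ feSpace K Ω Γ)
    (hLf : L * eLpNorm f (ENNReal.ofReal q) (volume.restrict Ω) ≠ ⊤)
    (hCLh : traceConst Ω p * L * eLpNorm h (ENNReal.ofReal q) ((surf d).restrict Γ) ≠ ⊤)
    (hCh : traceConst Ω p * eLpNorm h (ENNReal.ofReal q) ((surf d).restrict Γ) ≠ ⊤) :
    ‖∫ x in Γ, h x * u x ∂(surf d) + ∫ x in Ω, f x * u x‖ₑ ≤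
      (L * eLpNorm f (ENNReal.ofReal q) (volume.restrict Ω) * ENNReal.ofReal (p ^ (-(1 / p))) +
        traceConst Ω p * L * eLpNorm h (ENNReal.ofReal q) ((surf d).restrict Γ) *
          ENNReal.ofReal (p ^ (-(1 / p))) +
        traceConst Ω p * eLpNorm h (ENNReal.ofReal q) ((surf d).restrict Γ)) *
      eLpNorm (gradient u) (ENNReal.ofReal p) (volume.restrict Ω) := by
  have hfr : ContinuousOn u (frontier Ω) :=
    hu.1.1.mono (hK.space_eq ▸ frontier_subset_closure)
  have hum : AEStronglyMeasurable u ((surf d).restrict Γ) :=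
    (hfr.aestronglyMeasurable isClosed_frontier.measurableSet).mono_measure
      (Measure.restrict_mono hΓ le_rfl)
  have hA := enorm_integral_mul_le hpq hh.1 hum
  have hB := enorm_integral_mul_le hpq hf.1 (hu.1.aestronglyMeasurable hK)
  have hT : eLpNorm u (ENNReal.ofReal p) ((surf d).restrict Γ) ≤
      eLpNorm u (ENNReal.ofReal p) ((surf d).restrict (frontier Ω)) :=
    eLpNorm_mono_measure u (Measure.restrict_mono hΓ le_rfl)
  have hFr := fun hLt => eLpNorm_le_of_friedrichsLength_le hK hL hLt hu
  have hTr := fun hCt => eLpNorm_frontier_le (p := p) hK hCt hu.1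
  set C := traceConst Ω p
  set N := eLpNorm f (ENNReal.ofReal q) (volume.restrict Ω)
  set H := eLpNorm h (ENNReal.ofReal q) ((surf d).restrict Γ)
  set U := eLpNorm u (ENNReal.ofReal p) (volume.restrict Ω)
  set D := eLpNorm (gradient u) (ENNReal.ofReal p) (volume.restrict Ω)
  set c := ENNReal.ofReal (p ^ (-(1 / p)))
  -- Only the products are assumed finite: `L = ⊤` is harmless when its cofactor `k` vanishes, and
  -- likewise below for the trace constant when `H = 0`.
  have hmulU : ∀ k : ℝ≥0∞, L * k ≠ ⊤ → k * U ≤ L * k * c * D := by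
    intro k hk
    rcases eq_or_ne k 0 with rfl | hk0
    · simp
    have hLt : L ≠ ⊤ := by
      rintro rfl
      exact hk (ENNReal.top_mul hk0)
    calc k * U ≤ k * (L * (c * D)) := by gcongr; exact hFr hLt
      _ = L * k * c * D := by ring
  have hbd : H * eLpNorm u (ENNReal.ofReal p) ((surf d).restrict Γ) ≤ C * H * U + C * H * D := by
    rcases eq_or_ne H 0 with hH0 | hH0
    · simp [hH0]
    have hCt : C ≠ ⊤ := by
      intro hC
      exact hCh (by rw [hC, ENNReal.top_mul hH0])
    calc _ ≤ H * (C * (U + D)) := by gcongr; exact hT.trans (hTr hCt)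
      _ = _ := by ring
  calc _ ≤ _ := enorm_add_le _ _
    _ ≤ (C * H * U + C * H * D) + N * U := add_le_add (hA.trans hbd) hB
    _ ≤ (L * (C * H) * c * D + C * H * D) + L * N * c * D := by
        refine add_le_add (add_le_add ?_ le_rfl) (hmulU _ hLf)
        exact hmulU _ (by rwa [← mul_assoc, mul_comm L])
    _ = _ := by ring

/-! ### The search bound -/

theorem xNormPow_le_of_minimizer {p q : ℝ} {L : ℝ≥0∞} (hK : IsTriangulation K Ω)
    (hΓ : Γ ⊆ frontier Ω) (hp : 2 ≤ p) (hpq : p.HolderConjugate q)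
    (hL : friedrichsLength K Ω Γ p ≤ L) {f g h u : E d → ℝ}
    (hf : MemLp f (ENNReal.ofReal q) (volume.restrict Ω))
    (hh : MemLp h (ENNReal.ofReal q) ((surf d).restrict Γ)) (hg : IsPiecewiseLinear K g)
    (hu : u ∈ feSpace K Ω Γ)
    (hmin : ∀ v ∈ feSpace K Ω Γ, J Ω Γ p f g h u ≤ J Ω Γ p f g h v) {R : ℝ}
    (hR : searchBound Ω Γ p q L f g h ≤ ENNReal.ofReal R) :
    xNormPow Ω p (u + g) ≤ R := by
  have hp0 : 0 < p := by linarith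
  have hp1 : 0 < p - 1 := by linarith
  have hq0 : 0 < q := hpq.symm.pos
  have hvar := rpow_le_of_minimizer hK (by linarith) hg hu hmin
  have hload := enorm_load_le hK hΓ hpq hL hf hh hu
  rw [searchBound] at hR
  rw [(hu.1.add hg).xNormPow_eq hK hp0]
  rw [hg.xNormPow_eq hK hp0] at hR
  set C := traceConst Ω p
  set N := eLpNorm f (ENNReal.ofReal q) (volume.restrict Ω)
  set H := eLpNorm h (ENNReal.ofReal q) ((surf d).restrict Γ)
  set l := ∫ x in Γ, h x * u x ∂(surf d) + ∫ x in Ω, f x * u x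
  have hbr : L ^ q * N ^ q + C ^ q * (L ^ q + 1) * H ^ q =
      (L * N) ^ q + (C * L * H) ^ q + (C * H) ^ q := by
    simp only [ENNReal.mul_rpow_of_nonneg _ _ hq0.le]
    ring
  rw [hbr] at hR
  -- The bound lies below a real number and the factor `8 * (p - 1)` is nonzero, so the bracket is
  -- finite; from here on the argument uses real numbers.
  have hfin : (L * N) ^ q + (C * L * H) ^ q + (C * H) ^ q ≠ ⊤ := by
    intro htop
    rw [htop, ENNReal.mul_top (by simpa using hp1), add_top] at hR
    exact ENNReal.ofReal_ne_top (top_le_iff.1 hR)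
  have hne : ∀ k : ℝ≥0∞, k ^ q ≠ ⊤ → k ≠ ⊤ := by
    rintro k hk rfl
    exact hk (ENNReal.top_rpow_of_pos hq0)
  obtain ⟨h12, h3⟩ := ENNReal.add_ne_top.1 hfin
  obtain ⟨h1, h2⟩ := ENNReal.add_ne_top.1 h12
  have h1' := hne _ h1
  have h2' := hne _ h2
  have h3' := hne _ h3
  obtain ⟨a, ha⟩ : ∃ a : NNReal, L * N = a := ⟨_, (ENNReal.coe_toNNReal h1').symm⟩
  obtain ⟨b, hb⟩ : ∃ b : NNReal, C * L * H = b := ⟨_, (ENNReal.coe_toNNReal h2').symm⟩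
  obtain ⟨c, hc⟩ : ∃ c : NNReal, C * H = c := ⟨_, (ENNReal.coe_toNNReal h3').symm⟩
  replace hload := hload h1' h2' h3'
  rw [ha, hb, hc] at hload hR
  set k : ℝ := p ^ (-(1 / p))
  have hk0 : 0 ≤ k := Real.rpow_nonneg hp0.le _
  set S : ℝ := a * k + b * k + c with hS
  have hS0 : 0 ≤ S := by positivity
  have hlS : l ≤ S * gradNorm Ω p u := by
    have e := ENNReal.toReal_mono (ENNReal.mul_ne_top (by finiteness)
      (hu.1.memLp_gradient hK _).eLpNorm_ne_top) hload
    rw [ENNReal.toReal_mul, toReal_enorm, ENNReal.toReal_add (by finiteness) (by finiteness),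
      ENNReal.toReal_add (by finiteness) (by finiteness), ENNReal.toReal_mul, ENNReal.toReal_mul,
      ENNReal.toReal_ofReal hk0] at e
    exact (le_abs_self l).trans e
  have hX0 : 0 ≤ gradNorm Ω p (u + g) := ENNReal.toReal_nonneg
  have hG0 : 0 ≤ gradNorm Ω p g := ENNReal.toReal_nonneg
  -- This gives the constants `3` and `6`, which the `4` and `8` of `searchBound` dominate.
  have hfinal := rpow_le_of_variational hp hpq hX0 hG0 hS0
    (sum_rpow_le hp hpq a.coe_nonneg b.coe_nonneg c.coe_nonneg)
    (hvar.trans (by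
      gcongr
      refine hlS.trans ?_
      gcongr
      exact gradNorm_le_add hK (by linarith) hu.1 hg))
  -- A negative `R` would give `ENNReal.ofReal R = 0`, contradicting the summand `2` of the bound.
  have hR0 : 0 ≤ R := by
    by_contra! hneg
    rw [ENNReal.ofReal_of_nonpos hneg.le] at hR
    simp at hR
  have hGp : 0 ≤ gradNorm Ω p g ^ p := Real.rpow_nonneg hG0 p
  have hM0 : 0 ≤ (a : ℝ) ^ q + (b : ℝ) ^ q + (c : ℝ) ^ q := by positivity
  have hRr : 2 + 4 * gradNorm Ω p g ^ p +
      8 * (p - 1) * ((a : ℝ) ^ q + (b : ℝ) ^ q + (c : ℝ) ^ q) ≤ R := by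
    rw [← ENNReal.ofReal_le_ofReal_iff hR0]
    refine le_trans (le_of_eq ?_) hR
    rw [ENNReal.ofReal_add (by positivity) (by positivity),
      ENNReal.ofReal_add (by norm_num) (by positivity), ENNReal.ofReal_mul (by norm_num),
      ENNReal.ofReal_mul (by positivity), ENNReal.ofReal_mul (by norm_num),
      ENNReal.ofReal_add (by positivity) (by positivity),
      ENNReal.ofReal_add (by positivity) (by positivity)]
    simp only [← ENNReal.ofReal_rpow_of_nonneg (NNReal.coe_nonneg _) hq0.le,
      ENNReal.ofReal_coe_nnreal]
    simp
  have := mul_nonneg hp1.le hM0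
  linarith

/-- The gradient is constant on the interior of the element, which has full measure in it and lies
in `Ω`; the left side is thus the integral over one piece of a nonnegative integrand. -/
theorem weight_mul_le_xNormPow {p : ℝ} (hK : IsTriangulation K Ω) (hp : 0 < p) {v : E d → ℝ}
    (hv : IsPiecewiseLinear K v) {t : Finset (E d)} (ht : t ∈ elements K) :
    weight t * ‖gradient v (midpt t)‖ ^ p ≤ xNormPow Ω p v := by
  set s := interior (convexHull ℝ (t : Set (E d))) with hs
  have hint : IntegrableOn (fun x => ‖gradient v x‖ ^ p) Ω := by
    have := (hv.memLp_gradient hK (ENNReal.ofReal p)).integrable_norm_rpow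
      (by simpa using hp) (by simp)
    rwa [ENNReal.toReal_ofReal hp.le] at this
  have hvol : weight t = volume.real s := by
    rw [weight]
    refine measureReal_congr ?_
    exact (interior_ae_eq_of_null_frontier
      ((convex_convexHull ℝ (t : Set (E d))).addHaar_frontier volume)).symm
  calc weight t * ‖gradient v (midpt t)‖ ^ p
      = ∫ x in s, ‖gradient v (midpt t)‖ ^ p := by rw [setIntegral_const, hvol, smul_eq_mul]
    _ = ∫ x in s, ‖gradient v x‖ ^ p :=
        setIntegral_congr_fun isOpen_interior.measurableSet fun x hx => by
          simp only [hv.gradient_eq_midpt ht hx]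
    _ ≤ xNormPow Ω p v :=
        setIntegral_mono_set hint (.of_forall fun x => Real.rpow_nonneg (norm_nonneg _) p)
          (hK.interior_hull_subset ht).eventuallyLE

end

end PLaplace

theorem mainTheorem3 {d : ℕ} (K : Geometry.SimplicialComplex ℝ (PLaplace.E d))
    (Ω Γ : Set (PLaplace.E d)) (hK : PLaplace.IsTriangulation K Ω)
    (hΓ : Γ ⊆ frontier Ω) (hΓm : MeasurableSet Γ)
    (p q : ℝ) (hp : 2 ≤ p) (hpq : p.HolderConjugate q) :
    -- the width of `Ω`, seen from the Dirichlet part, is an admissible length `L`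
    (∀ w : ℝ, PLaplace.HasDirichletWidth Ω Γ w →
      PLaplace.friedrichsLength K Ω Γ p ≤ ENNReal.ofReal w) ∧
    -- the bound for every minimizer and every admissible length `L`
    (∀ L : ℝ≥0∞, PLaplace.friedrichsLength K Ω Γ p ≤ L → ∀ f g h : PLaplace.E d → ℝ,
      MemLp f (ENNReal.ofReal q) (volume.restrict Ω) →
      MemLp h (ENNReal.ofReal q) ((PLaplace.surf d).restrict Γ) →
      PLaplace.IsPiecewiseLinear K g →
      ∀ u ∈ PLaplace.feSpace K Ω Γ,
        (∀ v ∈ PLaplace.feSpace K Ω Γ,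
          PLaplace.J Ω Γ p f g h u ≤ PLaplace.J Ω Γ p f g h v) →
        ∀ R : ℝ,
          PLaplace.searchBound Ω Γ p q L f g h ≤ ENNReal.ofReal R →
          PLaplace.xNormPow Ω p (u + g) ≤ R ∧
          (u, fun t : PLaplace.elements K =>
              ‖gradient (u + g) (PLaplace.midpt (t : Finset (PLaplace.E d)))‖ ^ p)
            ∈ PLaplace.searchSet K Ω Γ p g R) := by
  refine ⟨fun w hw => PLaplace.friedrichsLength_le_of_hasDirichletWidth hK (by linarith) hw,
    fun L hL f g h hf hh hg u hu hmin R hR => ?_⟩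
  have hX := PLaplace.xNormPow_le_of_minimizer hK hΓ hp hpq hL hf hh hg hu hmin hR
  exact ⟨hX, hu, fun t => ⟨le_rfl,
    (PLaplace.weight_mul_le_xNormPow hK (by linarith) (hu.1.add hg) t.2).trans hX⟩⟩
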